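/- A \emph{constrained workflow authorization schema} is a tuple $W=((S,<),U,A,C)$, where $(S,<)$ is a finite (strictly) partially ordered set of steps, $U$ is a finite set of users, $A\subseteq S\times U$ is the authorization relation, and $C$ is a finite set of constraints $(T,\Theta)$ with $T\subseteq S$ and $\Theta$ a set of functions $T\to U$. A constraint $(T,\Theta)$ is \emph{user-independent} (UI) if $\phi\circ\theta\in\Theta$ for every $\theta\in\Theta$ and every permutation $\phi$ of $U$. A partial plan $\pi:S'\to U$ with $S'\subseteq S$ is \emph{valid} if $(s,\pi(s))\in A$ for all $s\in S'$, and $\pi|_T\in\Theta$ for every $(T,\Theta)\in C$ with $T\subseteq S'$. For an integer $t\ge 0$, $W$ is \emph{dynamically $t$-resilient} if Player 1 has a winning strategy in the following game of $k=|S|$ rounds, which starts from the empty plan $\pi$. In each round, Player 2 first chooses a set $B\subseteq U$ of at most $t$ unavailable users; then Player 1 chooses a step $s$ that has not been executed yet and all of whose predecessors in $(S,<)$ have been executed, together with a user $u\in U\setminus B$, and sets $\pi(s)=u$. Player 1 loses as soon as he cannot move or $\pi$ is not valid, and wins if all steps have been executed. Constraints are given in the input by their scopes $T$ and by descriptions in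 some constraint language such that, given $|S|$, $|U|$, a description and a function $\theta:T\to U$, one can check in polynomial time whether $\theta$ belongs to the described set $\Theta$. The rest of the input is listed explicitly (with $k$, $|U|$ and $t$ in unary), and $|x|$ denotes the size of the input $x=(W,t)$. Running times are counted in evaluation steps of programs in first-order pure Lisp over binary trees (equivalently, up to a polynomial, in steps of a Turing machine). \textbf{Theorem.} There is a computable function $f:\mathbb N\times\mathbb N\to\mathbb N$ such that for every such constraint language there are a program and a polynomial $p$ for which the following holds: for every input $x=(W,t)$ in which all constraints of $W$ are UI, the program decides whether $W$ is dynamically $t$-resilient in time at most $f(k,t)\cdot p(|x|)$, where $k=|S|$. That is, the problem can be solved in time $O^*(f(k,t))$, and is fixed-parameter tractable parameterized by $k+t$. -/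

import Mathlib

namespace Workflow

/-! ## Constrained workflow authorization schemas -/

/-- A workflow constraint `(T, Θ)` : a scope `T ⊆ S` and a family `Θ` of functions `T → U`. -/
structure Constraint (S U : Type) where
  scope : Finset S
  allowed : Set (scope → U)

/-- `(T, Θ)` is user-independent if `φ ∘ θ ∈ Θ` for all `θ ∈ Θ` and all permutations `φ` of `U`. -/
def Constraint.UserIndependent {S U : Type} (c : Constraint S U) : Prop :=
  ∀ θ ∈ c.allowed, ∀ φ : Equiv.Perm U, (fun s => φ (θ s)) ∈ c.allowed

/-- A constrained workflow authorization schema `((S, <), U, A, C)`. -/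
structure Schema (S U : Type) where
  lt : S → S → Prop
  lt_irrefl : ∀ s, ¬ lt s s
  lt_trans : ∀ s₁ s₂ s₃, lt s₁ s₂ → lt s₂ s₃ → lt s₁ s₃
  auth : S → U → Prop
  constraints : Set (Constraint S U)

/-- A partial plan `S' → U` with `S' ⊆ S`; a step outside `S'` has the value `none`. -/
abbrev Plan (S U : Type) := S → Option U

namespace Schema

variable {S U : Type}

def UserIndependent (W : Schema S U) : Prop :=
  ∀ c ∈ W.constraints, c.UserIndependent

/-- The plan assigns only authorized users. -/
def Authorized (W : Schema S U) (π : Plan S U) : Prop :=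
  ∀ s u, π s = some u → W.auth s u

/-- The plan satisfies a constraint if the scope is not contained in the domain of the plan, or
the restriction of the plan to the scope is allowed. (A function `θ` on the scope that agrees with
the plan exists exactly if the scope is contained in the domain, and is then the restriction.) -/
def Satisfies (π : Plan S U) (c : Constraint S U) : Prop :=
  ∀ θ : c.scope → U, (∀ s : c.scope, π s = some (θ s)) → θ ∈ c.allowed

def Valid (W : Schema S U) (π : Plan S U) : Prop :=
  W.Authorized π ∧ ∀ c ∈ W.constraints, Satisfies π c

/-- A step is ready if it has not been executed, and all steps that precede it have been. -/
def Ready (W : Schema S U) (π : Plan S U) (s : S) : Prop :=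
  π s = none ∧ ∀ s', W.lt s' s → π s' ≠ none

/-- Player 1 can win the remaining `r` rounds of the dynamic resiliency game, if the rounds played
so far have produced the partial plan `π`. In a round, Player 2 names a set `B` of at most `t`
unavailable users; then Player 1 names a ready step and an available user for it, and loses unless
the extended partial plan is valid. -/
def CanWin [DecidableEq S] (W : Schema S U) (t : ℕ) : ℕ → Plan S U → Prop
  | 0, _ => True
  | r + 1, π => ∀ B : Finset U, B.card ≤ t →
      ∃ s u, W.Ready π s ∧ u ∉ B ∧ W.Valid (Function.update π s (some u)) ∧
        CanWin W t r (Function.update π s (some u))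

/-- Dynamic `t`-resiliency: Player 1 can win the game that starts from the empty plan. Each round
executes one step, so that the game has `|S|` rounds. -/
def DynamicallyResilient [Fintype S] [DecidableEq S] (W : Schema S U) (t : ℕ) : Prop :=
  W.CanWin t (Fintype.card S) (fun _ => none)

end Schema

/-! ## The machine model

Programs of first-order pure Lisp: the data are binary trees, a program is a finite list of
(mutually recursive) one-argument function definitions, and the running time is the number of
evaluation steps. There is no test for equality of trees; every step takes a bounded number of
pointer operations, so that running times agree with those of Turing machines (and of random access
machines) up to a polynomial. -/

inductive Tree where
  | nil : Tree
  | cons : Tree → Tree → Tree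

namespace Tree

/-- The number of nodes. -/
def size : Tree → ℕ
  | nil => 1
  | cons a b => a.size + b.size + 1

def hd : Tree → Tree
  | nil => nil
  | cons a _ => a

def tl : Tree → Tree
  | nil => nil
  | cons _ b => b

end Tree

inductive Expr where
  /-- the argument of the function -/
  | arg : Expr
  | nil : Expr
  | cons : Expr → Expr → Expr
  | hd : Expr → Expr
  | tl : Expr → Expr
  /-- if the first expression is not `nil` then the second one, else the third one -/
  | ite : Expr → Expr → Expr → Expr
  /-- evaluate the second expression with the value of the first one as the argument -/
  | letIn : Expr → Expr → Expr
  /-- apply the function with the given number in the program to the value of the expression -/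
  | call : ℕ → Expr → Expr

/-- The list of the bodies of the functions. Function number `0` is the main function. -/
abbrev Program := List Expr

/-- `Eval P e x v τ` : in the program `P`, the expression `e` with argument `x` evaluates to `v` in
exactly `τ` steps. -/
inductive Eval (P : Program) : Expr → Tree → Tree → ℕ → Prop
  | arg (x : Tree) : Eval P .arg x x 1
  | nil (x : Tree) : Eval P .nil x .nil 1
  | cons {a b : Expr} {x u v : Tree} {m n : ℕ} :
      Eval P a x u m → Eval P b x v n → Eval P (.cons a b) x (.cons u v) (m + n + 1)
  | hd {a : Expr} {x u : Tree} {m : ℕ} : Eval P a x u m → Eval P (.hd a) x u.hd (m + 1)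
  | tl {a : Expr} {x u : Tree} {m : ℕ} : Eval P a x u m → Eval P (.tl a) x u.tl (m + 1)
  | iteTrue {c a b : Expr} {x u v : Tree} {m n : ℕ} :
      Eval P c x u m → u ≠ .nil → Eval P a x v n → Eval P (.ite c a b) x v (m + n + 1)
  | iteFalse {c a b : Expr} {x v : Tree} {m n : ℕ} :
      Eval P c x .nil m → Eval P b x v n → Eval P (.ite c a b) x v (m + n + 1)
  | letIn {a b : Expr} {x u v : Tree} {m n : ℕ} :
      Eval P a x u m → Eval P b u v n → Eval P (.letIn a b) x v (m + n + 1)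
  | call {f : ℕ} {a b : Expr} {x u v : Tree} {m n : ℕ} :
      P[f]? = some b → Eval P a x u m → Eval P b u v n → Eval P (.call f a) x v (m + n + 1)

/-- On input `x`, the program halts after at most `τ` steps, with an output that is not `nil`
if and only if the answer is yes. -/
def DecidesWithin (P : Program) (x : Tree) (τ : ℕ) (answer : Prop) : Prop :=
  ∃ v m, Eval P (.call 0 .arg) x v m ∧ m ≤ τ ∧ (v ≠ .nil ↔ answer)

/-! ## Encodings -/

def encNat : ℕ → Tree
  | 0 => .nil
  | n + 1 => .cons .nil (encNat n)

def encBool (b : Bool) : Tree := encNat b.toNat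

def encList : List Tree → Tree
  | [] => .nil
  | a :: l => .cons a (encList l)

def encMatrix {m n : ℕ} (M : Fin m → Fin n → Bool) : Tree :=
  encList (List.ofFn fun i => encList (List.ofFn fun j => encBool (M i j)))

def encScope {k : ℕ} (T : Finset (Fin k)) : Tree :=
  encList (List.ofFn fun s => encBool (decide (s ∈ T)))

/-- The table of a function on the scope `T`, with the entry `nil` for each step outside `T`. -/
def encAssignment {k n : ℕ} (T : Finset (Fin k)) (θ : T → Fin n) : Tree :=
  encList (List.ofFn fun s =>
    if h : s ∈ T then encList [encNat (θ ⟨s, h⟩)] else .nil)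

/-- A way of describing constraints: with `k` steps and `n` users, the description `d` stands for
the constraint `(T, Θ k n T d)` on the scope `T`. -/
abbrev ConstraintLanguage := (k n : ℕ) → (T : Finset (Fin k)) → Tree → Set (T → Fin n)

/-- Whether an assignment satisfies a described constraint can be checked in polynomial time. -/
def ConstraintLanguage.PolyTimeCheckable (Θ : ConstraintLanguage) : Prop :=
  ∃ (P : Program) (p : Polynomial ℕ), ∀ (k n : ℕ) (T : Finset (Fin k)) (d : Tree) (θ : T → Fin n),
    let x := encList [encNat k, encNat n, d, encAssignment T θ]
    DecidesWithin P x (p.eval x.size) (θ ∈ Θ k n T d)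

/-- An instance of the resiliency problem, with `k` numbered steps, `n` numbered users, the
resiliency bound `t`, the strict partial order on the steps, the authorization relation, and the
list of the constraints, each given by its scope and its description. -/
structure Instance where
  k : ℕ
  n : ℕ
  t : ℕ
  lt : Fin k → Fin k → Bool
  lt_irrefl : ∀ s, ¬ lt s s
  lt_trans : ∀ s₁ s₂ s₃, lt s₁ s₂ → lt s₂ s₃ → lt s₁ s₃
  auth : Fin k → Fin n → Bool
  constraints : List (Finset (Fin k) × Tree)

namespace Instance

def schema (I : Instance) (Θ : ConstraintLanguage) : Schema (Fin I.k) (Fin I.n) where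
  lt s s' := I.lt s s' = true
  lt_irrefl := I.lt_irrefl
  lt_trans := I.lt_trans
  auth s u := I.auth s u = true
  constraints := {c | ∃ q ∈ I.constraints, c = ⟨q.1, Θ I.k I.n q.1 q.2⟩}

def encode (I : Instance) : Tree :=
  encList [encNat I.k, encNat I.n, encNat I.t, encMatrix I.lt, encMatrix I.auth,
    encList (I.constraints.map fun q => .cons (encScope q.1) q.2)]

end Instance

end Workflow

/-!
The set `B` of unavailable users need not be enumerated: Player 2 can block all winning moves of
Player 1 if and only if these moves involve at most `t` users. So a position is winning if and only
if more than `t` users have a winning move (`Schema.canWin_succ_iff_card`).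

To bound the number of candidates by a function of `k` and `t`, call two users twins if they are
authorized for the same steps. Since all constraints are user-independent, exchanging two twins
preserves winning positions, so that twins that do not occur in the plan are equally good. At most
`k` users occur in a plan. If from each of the at most `2 ^ k` classes of twins the first
`k + t + 1` users are kept, and a user that is not kept has a winning move, then more than `t` of
its kept twins do not occur in the plan and have one as well. Hence it suffices to count kept users
(`Instance.canWin_succ_iff_countP`), of which there are at most `2 ^ k * (k + t + 1)`. Plain search
through the moves by kept users visits at most `searchBound k t` states, and the work at each of
them is polynomial, including the calls of the checker of the constraint language. The checker
enters the polynomial only, and so `searchBound` serves all constraint languages.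

The programs are not written down, but composed. `PolyTime M i o` says that some program computes
the trees `o a` from the trees `i a`, in time polynomial in `M a`. It is closed under the
constructors of the language, case distinction and recursion along lists (`PolyTime.foldr`); all of
these paste programs together by renumbering functions. As each instruction takes one step whatever
the size of its data, polynomial bounds are needed only for the lengths of the lists, and for the
inputs of the checker. The search itself is an instance of `PolyTime.search`, whose running time is
the number of visited states times a polynomial.
-/

namespace Workflow

/-! ### Combining programs -/

/-- Renumber the functions of an expression by adding `m`. -/
def Expr.shift (m : ℕ) : Expr → Expr
  | .arg => .arg
  | .nil => .nil
  | .cons a b => .cons (a.shift m) (b.shift m)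
  | .hd a => .hd (a.shift m)
  | .tl a => .tl (a.shift m)
  | .ite c a b => .ite (c.shift m) (a.shift m) (b.shift m)
  | .letIn a b => .letIn (a.shift m) (b.shift m)
  | .call f a => .call (m + f) (a.shift m)

theorem Eval.append {P : Program} {e : Expr} {x v : Tree} {τ : ℕ} (h : Eval P e x v τ)
    (Q : Program) : Eval (P ++ Q) e x v τ := by
  induction h with
  | arg x => exact .arg x
  | nil x => exact .nil x
  | cons _ _ ha hb => exact .cons ha hb
  | hd _ ha => exact .hd ha
  | tl _ ha => exact .tl ha
  | iteTrue _ hu _ hc ha => exact .iteTrue hc hu ha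
  | iteFalse _ _ hc hb => exact .iteFalse hc hb
  | letIn _ _ ha hb => exact .letIn ha hb
  | call hf _ _ ha hb =>
    refine .call ?_ ha hb
    obtain ⟨hlt, _⟩ := List.getElem?_eq_some_iff.1 hf
    rw [List.getElem?_append_left hlt, hf]

theorem Eval.shift {P : Program} {e : Expr} {x v : Tree} {τ : ℕ} (h : Eval P e x v τ)
    (Q : Program) : Eval (Q ++ P.map (Expr.shift Q.length)) (e.shift Q.length) x v τ := by
  induction h with
  | arg x => exact .arg x
  | nil x => exact .nil x
  | cons _ _ ha hb => exact .cons ha hb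
  | hd _ ha => exact .hd ha
  | tl _ ha => exact .tl ha
  | iteTrue _ hu _ hc ha => exact .iteTrue hc hu ha
  | iteFalse _ _ hc hb => exact .iteFalse hc hb
  | letIn _ _ ha hb => exact .letIn ha hb
  | call hf _ _ ha hb =>
    refine .call ?_ ha hb
    rw [List.getElem?_append_right (by omega)]
    simp [hf]

/-! ### Functions that are bounded by a polynomial -/

/-- `b` is bounded by a polynomial in `M`. -/
def PolyBounded {α : Type} (M b : α → ℕ) : Prop :=
  ∃ q : Polynomial ℕ, ∀ a, b a ≤ q.eval (M a)

namespace PolyBounded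

variable {α β : Type} {M b c : α → ℕ}

theorem mono (hb : PolyBounded M b) (h : ∀ a, c a ≤ b a) : PolyBounded M c :=
  let ⟨q, hq⟩ := hb
  ⟨q, fun a => (h a).trans (hq a)⟩

theorem const (m : ℕ) : PolyBounded M fun _ => m :=
  ⟨Polynomial.C m, fun a => by simp⟩

theorem self : PolyBounded M M := ⟨Polynomial.X, fun a => by simp⟩

theorem add (hb : PolyBounded M b) (hc : PolyBounded M c) :
    PolyBounded M fun a => b a + c a := by
  obtain ⟨p, hp⟩ := hb
  obtain ⟨q, hq⟩ := hc
  exact ⟨p + q, fun a => by rw [Polynomial.eval_add]; exact Nat.add_le_add (hp a) (hq a)⟩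

theorem mul (hb : PolyBounded M b) (hc : PolyBounded M c) :
    PolyBounded M fun a => b a * c a := by
  obtain ⟨p, hp⟩ := hb
  obtain ⟨q, hq⟩ := hc
  exact ⟨p * q, fun a => by rw [Polynomial.eval_mul]; exact Nat.mul_le_mul (hp a) (hq a)⟩

theorem comap (hb : PolyBounded M b) (g : β → α) :
    PolyBounded (fun x => M (g x)) fun x => b (g x) :=
  let ⟨q, hq⟩ := hb
  ⟨q, fun x => hq (g x)⟩

theorem eval_mono (p : Polynomial ℕ) {m n : ℕ} (h : m ≤ n) : p.eval m ≤ p.eval n := by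
  induction p using Polynomial.induction_on' with
  | add p q hp hq => simp only [Polynomial.eval_add]; exact Nat.add_le_add hp hq
  | monomial d a =>
    simp only [Polynomial.eval_monomial]
    exact Nat.mul_le_mul_left _ (Nat.pow_le_pow_left h d)

theorem eval (p : Polynomial ℕ) (hb : PolyBounded M b) : PolyBounded M fun a => p.eval (b a) := by
  obtain ⟨q, hq⟩ := hb
  exact ⟨p.comp q, fun a => by rw [Polynomial.eval_comp]; exact eval_mono p (hq a)⟩

end PolyBounded

/-! ### A calculus of polynomial-time computations -/

/-- The trees `o a` are computed from the trees `i a`, by one expression over one program, in time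
polynomial in `M a`. The index `a` is the context of the computation, of which `i a` is the
representation that is available to the program. As no instruction depends on the size of the data,
sizes do not enter: `M` only has to bound the numbers of iterations. -/
def PolyTime {α : Type} (M : α → ℕ) (i o : α → Tree) : Prop :=
  ∃ (P : Program) (e : Expr) (b : α → ℕ), PolyBounded M b ∧
    ∀ a, ∃ τ ≤ b a, Eval P e (i a) (o a) τ

/-- Two computations can be carried out over one program. -/
theorem PolyTime.exists_common {α β : Type} {M : α → ℕ} {i o : α → Tree} {M' : β → ℕ}
    {i' o' : β → Tree} (h : PolyTime M i o) (h' : PolyTime M' i' o') :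
    ∃ (P : Program) (e e' : Expr) (b : α → ℕ) (b' : β → ℕ), PolyBounded M b ∧
      PolyBounded M' b' ∧ (∀ a, ∃ τ ≤ b a, Eval P e (i a) (o a) τ) ∧
      ∀ a, ∃ τ ≤ b' a, Eval P e' (i' a) (o' a) τ := by
  obtain ⟨P, e, b, hb, H⟩ := h
  obtain ⟨P', e', b', hb', H'⟩ := h'
  refine ⟨P ++ P'.map (Expr.shift P.length), e, e'.shift P.length, b, b', hb, hb', ?_, ?_⟩
  · intro a
    obtain ⟨τ, hτ, h⟩ := H a
    exact ⟨τ, hτ, h.append _⟩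
  · intro a
    obtain ⟨τ, hτ, h⟩ := H' a
    exact ⟨τ, hτ, h.shift _⟩

namespace PolyTime

variable {α β : Type} {M : α → ℕ} {i o o' r : α → Tree}

theorem arg : PolyTime M i i :=
  ⟨[], .arg, fun _ => 1, .const 1, fun _ => ⟨1, le_rfl, .arg _⟩⟩

theorem nil : PolyTime M i fun _ => .nil :=
  ⟨[], .nil, fun _ => 1, .const 1, fun _ => ⟨1, le_rfl, .nil _⟩⟩

theorem congr (h : PolyTime M i o) (he : ∀ a, o a = o' a) : PolyTime M i o' := by
  rwa [← funext he]

theorem cons (h : PolyTime M i o) (h' : PolyTime M i o') :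
    PolyTime M i fun a => .cons (o a) (o' a) := by
  obtain ⟨P, e, e', b, b', hb, hb', H, H'⟩ := h.exists_common h'
  refine ⟨P, .cons e e', _, (hb.add hb').add (.const 1), fun a => ?_⟩
  obtain ⟨τ, hτ, h⟩ := H a
  obtain ⟨τ', hτ', h'⟩ := H' a
  exact ⟨_, by omega, .cons h h'⟩

theorem hd (h : PolyTime M i o) : PolyTime M i fun a => (o a).hd := by
  obtain ⟨P, e, b, hb, H⟩ := h
  refine ⟨P, .hd e, _, hb.add (.const 1), fun a => ?_⟩
  obtain ⟨τ, hτ, h⟩ := H a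
  exact ⟨_, by omega, .hd h⟩

theorem tl (h : PolyTime M i o) : PolyTime M i fun a => (o a).tl := by
  obtain ⟨P, e, b, hb, H⟩ := h
  refine ⟨P, .tl e, _, hb.add (.const 1), fun a => ?_⟩
  obtain ⟨τ, hτ, h⟩ := H a
  exact ⟨_, by omega, .tl h⟩

theorem comp (h : PolyTime M i o) (h' : PolyTime M o r) : PolyTime M i r := by
  obtain ⟨P, e, e', b, b', hb, hb', H, H'⟩ := h.exists_common h'
  refine ⟨P, .letIn e e', _, (hb.add hb').add (.const 1), fun a => ?_⟩
  obtain ⟨τ, hτ, h⟩ := H a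
  obtain ⟨τ', hτ', h'⟩ := H' a
  exact ⟨_, by omega, .letIn h h'⟩

theorem comap (h : PolyTime M i o) (g : β → α) :
    PolyTime (fun x => M (g x)) (fun x => i (g x)) fun x => o (g x) := by
  obtain ⟨P, e, b, hb, H⟩ := h
  exact ⟨P, e, _, hb.comap g, fun x => H (g x)⟩

/-- A computation can be used in a larger context, from which its own context is computable. -/
theorem lift (h : PolyTime M i o) {j : β → Tree} (g : β → α)
    (hg : PolyTime (fun x => M (g x)) j fun x => i (g x)) :
    PolyTime (fun x => M (g x)) j fun x => o (g x) :=
  hg.comp (h.comap g)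

/-- Case distinction. Each branch has to be computed only where it is taken. -/
theorem cases {c : α → Tree} (hc : PolyTime M i c)
    (h₁ : PolyTime (fun a : {a // c a ≠ .nil} => M a) (fun a => i a) fun a => o a)
    (h₂ : PolyTime (fun a : {a // c a = .nil} => M a) (fun a => i a) fun a => o a) :
    PolyTime M i o := by
  obtain ⟨P₁, e₁, e₂, b₁, b₂, ⟨q₁, hq₁⟩, ⟨q₂, hq₂⟩, H₁, H₂⟩ := h₁.exists_common h₂
  obtain ⟨P, e, b, hb, H⟩ := hc
  refine ⟨P ++ P₁.map (Expr.shift P.length),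
    .ite e (e₁.shift P.length) (e₂.shift P.length), _,
    ((hb.add ⟨q₁, fun _ => le_rfl⟩).add ⟨q₂, fun _ => le_rfl⟩).add (.const 1), fun a => ?_⟩
  obtain ⟨τ, hτ, h⟩ := H a
  by_cases ha : c a = .nil
  · obtain ⟨τ', hτ', h'⟩ := H₂ ⟨a, ha⟩
    have := hq₂ ⟨a, ha⟩
    exact ⟨_, by dsimp only at *; omega, .iteFalse (ha ▸ h.append _) (h'.shift _)⟩
  · obtain ⟨τ', hτ', h'⟩ := H₁ ⟨a, ha⟩
    have := hq₁ ⟨a, ha⟩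
    exact ⟨_, by dsimp only at *; omega, .iteTrue (h.append _) ha (h'.shift _)⟩

/-- Recursion along a list. The value `V a l'` is computed for all suffixes `l'` of the list. -/
theorem foldr {β : α → Type} {l : ∀ a, List (β a)} {eb : ∀ a, β a → Tree}
    {V : ∀ a, List (β a) → Tree}
    (hl : PolyTime M i fun a => encList ((l a).map (eb a)))
    (hlen : PolyBounded M fun a => (l a).length)
    (hz : PolyTime M i fun a => V a [])
    (hs : PolyTime (fun x : Σ a, {p : β a × List (β a) // p.1 :: p.2 <:+ l a} => M x.1)
      (fun x => .cons (i x.1) (.cons (eb x.1 x.2.1.1) (V x.1 x.2.1.2)))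
      fun x => V x.1 (x.2.1.1 :: x.2.1.2)) :
    PolyTime M i fun a => V a (l a) := by
  obtain ⟨P₁, el, ez, bl, bz, hbl, hbz, Hl, Hz⟩ := hl.exists_common hz
  obtain ⟨P₂, es, bs, ⟨qs, hqs⟩, Hs⟩ := hs
  -- The function `0` takes the environment and the rest of the list; the programs for the list, the
  -- start value and the step, joined to `P₃`, are shifted behind it.
  set P₃ := P₁ ++ P₂.map (Expr.shift P₁.length)
  set body : Expr := .ite (.tl .arg)
    (.letIn (.cons (.hd .arg) (.cons (.hd (.tl .arg))
        (.call 0 (.cons (.hd .arg) (.tl (.tl .arg))))))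
      ((es.shift P₁.length).shift 1))
    (.letIn (.hd .arg) (ez.shift 1))
  set P : Program := [body] ++ P₃.map (Expr.shift 1)
  have key : ∀ a (l' : List (β a)), l' <:+ l a →
      ∃ τ ≤ (l'.length + 1) * (qs.eval (M a) + bz a + 20),
        Eval P body (.cons (i a) (encList (l'.map (eb a)))) (V a l') τ := by
    intro a l'
    induction l' with
    | nil =>
      intro _
      obtain ⟨τ, hτ, h⟩ := Hz a
      refine ⟨_, ?_, .iteFalse (.tl (.arg _)) (.letIn (.hd (.arg _))
        ((h.append _).shift [body]))⟩
      simp only [List.length_nil]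
      omega
    | cons c l' ih =>
      intro hsuf
      obtain ⟨τ, hτ, h⟩ := ih ((List.suffix_cons c l').trans hsuf)
      obtain ⟨τ', hτ', h'⟩ := Hs ⟨a, (c, l'), hsuf⟩
      have hq := hqs ⟨a, (c, l'), hsuf⟩
      refine ⟨_, ?_, .iteTrue (.tl (.arg _)) (by simp [encList, Tree.tl]) (.letIn
        (.cons (.hd (.arg _)) (.cons (.hd (.tl (.arg _)))
          (.call (b := body) rfl (.cons (.hd (.arg _)) (.tl (.tl (.arg _)))) h)))
        ((h'.shift P₁).shift [body]))⟩
      simp only [List.length_cons]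
      rw [add_mul _ 1]
      dsimp only at hq
      omega
  refine ⟨P, .call 0 (.cons .arg (el.shift 1)), _,
    (hbl.add ((hlen.add (.const 1)).mul
      (((PolyBounded.self.eval qs).add hbz).add
        (.const 20)))).add (.const 10), fun a => ?_⟩
  obtain ⟨τ, hτ, h⟩ := key a (l a) List.suffix_rfl
  obtain ⟨τ', hτ', h'⟩ := Hl a
  refine ⟨_, ?_, .call (b := body) rfl (.cons (.arg _) ((h'.append _).shift [body])) h⟩
  omega

end PolyTime

/-- Recursion along a tree of states: the program computes a step `y s` from a state `s`, which is
either the final value, or consists of three further states, of which the value of the first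
decides whether the value of the second or that of the third is returned. The time is bounded by
the number `N s` of the states that are visited, times a polynomial. -/
theorem PolyTime.search {σ : Type} {M N : σ → ℕ} {i y F : σ → Tree} (hy : PolyTime M i y)
    (hN : ∀ s, 0 < N s)
    (hF : ∀ s, y s = .cons .nil (F s) ∨ ∃ u a b c, u ≠ Tree.nil ∧
      y s = .cons u (.cons (i a) (.cons (i b) (i c))) ∧ M a = M s ∧ M b = M s ∧ M c = M s ∧
      ((F a ≠ .nil ∧ F s = F b ∧ N a + N b < N s) ∨
        (F a = .nil ∧ F s = F c ∧ N a + N c < N s))) :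
    ∃ (P : Program) (e : Expr) (p : Polynomial ℕ), ∀ s,
      ∃ τ ≤ N s * p.eval (M s), Eval P e (i s) (F s) τ := by
  obtain ⟨P₁, e, b, ⟨q, hq⟩, H⟩ := hy
  -- The function `0` computes the step, and branches to itself or returns the final value.
  set body : Expr := .letIn (e.shift 1) (.ite (.hd .arg)
    (.ite (.call 0 (.hd (.tl .arg))) (.call 0 (.hd (.tl (.tl .arg))))
      (.call 0 (.tl (.tl (.tl .arg))))) (.tl .arg))
  set P : Program := [body] ++ P₁.map (Expr.shift 1)
  refine ⟨P, body, q + Polynomial.C 30, ?_⟩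
  intro s
  induction hn : N s using Nat.strong_induction_on generalizing s with
  | _ n ih =>
    subst hn
    obtain ⟨τ, hτ, h⟩ := H s
    replace h := h.shift [body]
    replace hτ := hτ.trans (hq s)
    have hNs := hN s
    simp only [Polynomial.eval_add, Polynomial.eval_C] at ih ⊢
    rcases hF s with hs | ⟨u, a, b, c, hu, hs, hMa, hMb, hMc, hcase⟩ <;> rw [hs] at h
    · refine ⟨_, ?_, .letIn h (.iteFalse (.hd (.arg _)) (.tl (.arg _)))⟩
      have : 1 * (q.eval (M s) + 30) ≤ N s * (q.eval (M s) + 30) := Nat.mul_le_mul_right _ hNs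
      omega
    · rcases hcase with ⟨ha, hFs, hlt⟩ | ⟨ha, hFs, hlt⟩
      · obtain ⟨τa, hτa, hea⟩ := ih (N a) (by omega) a rfl
        obtain ⟨τb, hτb, heb⟩ := ih (N b) (by omega) b rfl
        rw [hMa] at hτa
        rw [hMb] at hτb
        rw [hFs]
        refine ⟨_, ?_, .letIn h (.iteTrue (.hd (.arg _)) hu (.iteTrue
          (.call (b := body) rfl (.hd (.tl (.arg _))) hea) ha
          (.call (b := body) rfl (.hd (.tl (.tl (.arg _)))) heb)))⟩
        have : (N a + N b + 1) * (q.eval (M s) + 30) ≤ N s * (q.eval (M s) + 30) :=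
          Nat.mul_le_mul_right _ hlt
        rw [add_mul, add_mul] at this
        omega
      · obtain ⟨τa, hτa, hea⟩ := ih (N a) (by omega) a rfl
        obtain ⟨τc, hτc, hec⟩ := ih (N c) (by omega) c rfl
        rw [hMa] at hτa
        rw [hMc] at hτc
        rw [hFs]
        rw [ha] at hea
        refine ⟨_, ?_, .letIn h (.iteTrue (.hd (.arg _)) hu (.iteFalse
          (.call (b := body) rfl (.hd (.tl (.arg _))) hea)
          (.call (b := body) rfl (.tl (.tl (.tl (.arg _)))) hec)))⟩
        have : (N a + N c + 1) * (q.eval (M s) + 30) ≤ N s * (q.eval (M s) + 30) :=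
          Nat.mul_le_mul_right _ hlt
        rw [add_mul, add_mul] at this
        omega

/-! ### Truth values, lists and numbers -/

open Classical in
/-- The truth value of a proposition, as a tree. -/
noncomputable def truth (p : Prop) : Tree := if p then .cons .nil .nil else .nil

theorem truth_of {p : Prop} (h : p) : truth p = .cons .nil .nil := if_pos h

theorem truth_of_not {p : Prop} (h : ¬ p) : truth p = .nil := if_neg h

theorem truth_ne_nil {p : Prop} : truth p ≠ .nil ↔ p := by
  by_cases h : p <;> simp [truth, h]

theorem truth_eq_nil {p : Prop} : truth p = .nil ↔ ¬ p := by
  by_cases h : p <;> simp [truth, h]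

theorem Tree.hd_cons (a b : Tree) : (Tree.cons a b).hd = a := rfl

theorem Tree.tl_cons (a b : Tree) : (Tree.cons a b).tl = b := rfl

theorem encBool_eq_truth (b : Bool) : encBool b = truth (b = true) := by
  cases b <;> simp [encBool, encNat, truth]

theorem encNat_eq_nil {n : ℕ} : encNat n = .nil ↔ n = 0 := by
  cases n <;> simp [encNat]

theorem encList_eq_nil {l : List Tree} : encList l = .nil ↔ l = [] := by
  cases l <;> simp [encList]

theorem encList_tl (l : List Tree) : (encList l).tl = encList l.tail := by
  cases l <;> rfl

theorem encNat_tl (n : ℕ) : (encNat n).tl = encNat (n - 1) := by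
  cases n <;> rfl

theorem encNat_eq_encList (n : ℕ) : encNat n = encList (List.replicate n .nil) := by
  induction n with
  | zero => rfl
  | succ n ih => simp [encNat, List.replicate_succ, encList, ih]

namespace PolyTime

variable {α : Type} {M : α → ℕ} {i o : α → Tree} {p q : α → Prop}

theorem restrict (h : PolyTime M i o) (p : α → Prop) :
    PolyTime (fun a : {a // p a} => M a) (fun a => i a) fun a => o a :=
  h.comap _

/-- What is computable in a context remains so when a component `j` is added to it. -/
theorem outer {γ : α → Type} (h : PolyTime M i o) (j : (Σ a, γ a) → Tree) :
    PolyTime (fun x : Σ a, γ a => M x.1) (fun x => .cons (i x.1) (j x)) fun x => o x.1 :=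
  h.lift Sigma.fst (PolyTime.arg.hd)

/-- The component that was added last is available. -/
theorem inner {j : α → Tree} : PolyTime M (fun x => .cons (i x) (j x)) j := PolyTime.arg.tl

theorem ite_prop (hc : PolyTime M i fun a => truth (p a))
    (h₁ : PolyTime (fun a : {a // p a} => M a) (fun a => i a) fun a => o a)
    (h₂ : PolyTime (fun a : {a // ¬ p a} => M a) (fun a => i a) fun a => o a) :
    PolyTime M i o :=
  hc.cases (h₁.comap fun a : {a // truth (p a) ≠ .nil} => ⟨a.1, truth_ne_nil.1 a.2⟩)
    (h₂.comap fun a : {a // truth (p a) = .nil} => ⟨a.1, truth_eq_nil.1 a.2⟩)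

theorem true_of (h : ∀ a, p a) : PolyTime M i fun a => truth (p a) :=
  (nil.cons nil).congr fun a => (truth_of (h a)).symm

theorem false_of (h : ∀ a, ¬ p a) : PolyTime M i fun a => truth (p a) :=
  nil.congr fun a => (truth_of_not (h a)).symm

/-- Replace the proposition whose truth value is computed by an equivalent one. -/
theorem iff_congr (h : PolyTime M i fun a => truth (p a)) (he : ∀ a, p a ↔ q a) :
    PolyTime M i fun a => truth (q a) :=
  h.congr fun a => by rw [he a]

theorem ne_nil (h : PolyTime M i o) : PolyTime M i fun a => truth (o a ≠ .nil) :=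
  h.cases (true_of fun a => a.2) (false_of fun a => not_not.2 a.2)

theorem not (h : PolyTime M i fun a => truth (p a)) : PolyTime M i fun a => truth (¬ p a) :=
  h.ite_prop (false_of fun a => not_not.2 a.2) (true_of fun a => a.2)

theorem imp (hp : PolyTime M i fun a => truth (p a))
    (hq : PolyTime (fun a : {a // p a} => M a) (fun a => i a) fun a => truth (q a)) :
    PolyTime M i fun a => truth (p a → q a) :=
  hp.ite_prop (hq.iff_congr fun a => ⟨fun h _ => h, fun h => h a.2⟩)
    (true_of fun a h => absurd h a.2)

theorem and (hp : PolyTime M i fun a => truth (p a))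
    (hq : PolyTime M i fun a => truth (q a)) :
    PolyTime M i fun a => truth (p a ∧ q a) :=
  hp.ite_prop ((hq.restrict p).iff_congr fun a => ⟨fun h => ⟨a.2, h⟩, fun h => h.2⟩)
    (false_of fun a h => absurd h.1 a.2)

theorem iff (hp : PolyTime M i fun a => truth (p a))
    (hq : PolyTime M i fun a => truth (q a)) :
    PolyTime M i fun a => truth (p a ↔ q a) :=
  ((hp.imp (hq.restrict p)).and (hq.imp (hp.restrict q))).iff_congr fun _ => iff_def.symm

section Lists

variable {β : α → Type} {l : ∀ a, List (β a)} {eb : ∀ a, β a → Tree}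

theorem forall_mem {p : ∀ a, β a → Prop}
    (hl : PolyTime M i fun a => encList ((l a).map (eb a)))
    (hlen : PolyBounded M fun a => (l a).length)
    (hp : PolyTime (fun x : Σ a, {b // b ∈ l a} => M x.1)
      (fun x => .cons (i x.1) (eb x.1 x.2)) fun x => truth (p x.1 x.2)) :
    PolyTime M i fun a => truth (∀ b ∈ l a, p a b) := by
  refine foldr (V := fun a l' => truth (∀ b ∈ l', p a b)) hl hlen
    (true_of fun a => by simp) ?_
  refine ((hp.lift (fun x : Σ a, {p : β a × List (β a) // p.1 :: p.2 <:+ l a} =>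
    ⟨x.1, x.2.1.1, x.2.2.subset List.mem_cons_self⟩) ?_).and
      (q := fun x => ∀ b ∈ x.2.1.2, p x.1 b) ?_).iff_congr fun x => by simp
  · exact PolyTime.arg.hd.cons PolyTime.arg.tl.hd
  · exact PolyTime.arg.tl.tl

theorem map {g : ∀ a, β a → Tree}
    (hl : PolyTime M i fun a => encList ((l a).map (eb a)))
    (hlen : PolyBounded M fun a => (l a).length)
    (hg : PolyTime (fun x : Σ a, {b // b ∈ l a} => M x.1)
      (fun x => .cons (i x.1) (eb x.1 x.2)) fun x => g x.1 x.2) :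
    PolyTime M i fun a => encList ((l a).map (g a)) := by
  refine foldr (V := fun a l' => encList (l'.map (g a))) hl hlen nil ?_
  refine (hg.lift (fun x : Σ a, {p : β a × List (β a) // p.1 :: p.2 <:+ l a} =>
    ⟨x.1, x.2.1.1, x.2.2.subset List.mem_cons_self⟩) ?_).cons
      (o' := fun x => encList (x.2.1.2.map (g x.1))) ?_
  · exact PolyTime.arg.hd.cons PolyTime.arg.tl.hd
  · exact PolyTime.arg.tl.tl

theorem filter {p : ∀ a, β a → Bool}
    (hl : PolyTime M i fun a => encList ((l a).map (eb a)))
    (hlen : PolyBounded M fun a => (l a).length)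
    (hp : PolyTime (fun x : Σ a, {b // b ∈ l a} => M x.1)
      (fun x => .cons (i x.1) (eb x.1 x.2)) fun x => truth (p x.1 x.2 = true)) :
    PolyTime M i fun a => encList (((l a).filter (p a)).map (eb a)) := by
  refine foldr (V := fun a l' => encList ((l'.filter (p a)).map (eb a))) hl hlen nil ?_
  refine (hp.lift (fun x : Σ a, {p : β a × List (β a) // p.1 :: p.2 <:+ l a} =>
    ⟨x.1, x.2.1.1, x.2.2.subset List.mem_cons_self⟩) ?_).ite_prop ?_ ?_
  · exact PolyTime.arg.hd.cons PolyTime.arg.tl.hd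
  · exact (PolyTime.arg.tl.hd.cons PolyTime.arg.tl.tl).congr fun x => by
      simp [List.filter_cons_of_pos x.2, encList, Tree.hd, Tree.tl]
  · exact (PolyTime.arg.tl.tl).congr fun x => by
      simp [List.filter_cons_of_neg x.2, Tree.tl]

end Lists

/-- Recursion along the numeral of `m a`, a list of `m a` trees, removes one item at a time. -/
theorem drop {m : α → ℕ} {L : α → List Tree} (hm : PolyTime M i fun a => encNat (m a))
    (hlen : PolyBounded M m) (hL : PolyTime M i fun a => encList (L a)) :
    PolyTime M i fun a => encList ((L a).drop (m a)) := by
  have := foldr (l := fun a => List.replicate (m a) Tree.nil) (eb := fun _ t => t)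
    (V := fun a l' => encList ((L a).drop l'.length))
    (hm.congr fun a => by rw [List.map_id', encNat_eq_encList])
    (hlen.mono fun a => by simp) (hL.congr fun a => by simp)
    ((PolyTime.arg.tl.tl.tl).congr fun x => by
      simp [Tree.tl_cons, encList_tl])
  exact this.congr fun a => by simp

/-- Numbers are compared by removing as many items from the numeral of `m a` as `n a` says. -/
theorem le {m n : α → ℕ} (hm : PolyTime M i fun a => encNat (m a))
    (hn : PolyTime M i fun a => encNat (n a)) (hlen : PolyBounded M n) :
    PolyTime M i fun a => truth (m a ≤ n a) :=
  (drop (L := fun a => List.replicate (m a) .nil) hn hlen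
    (hm.congr fun a => encNat_eq_encList _)).ne_nil.not.iff_congr fun a => by
      simp [encList_eq_nil, Nat.sub_eq_zero_iff_le]

/-- Access to the table of a function on `Fin (k a)`. -/
theorem getFin {k : α → ℕ} {f : ∀ a, Fin (k a) → Tree} {s : ∀ a, Fin (k a)}
    (hf : PolyTime M i fun a => encList (List.ofFn (f a)))
    (hs : PolyTime M i fun a => encNat (s a)) (hk : PolyBounded M k) :
    PolyTime M i fun a => f a (s a) :=
  (drop hs (hk.mono fun a => (s a).2.le) hf).hd.congr fun a => by
    rw [List.drop_eq_getElem_cons (by simp)]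
    simp [encList, Tree.hd]

/-- The list of the numbers below `k`, in increasing order. -/
theorem finRange {k : α → ℕ} (hk : PolyTime M i fun a => encNat (k a)) (hlen : PolyBounded M k) :
    PolyTime M i fun a => encList ((List.finRange (k a)).map fun s : Fin (k a) => encNat s) := by
  -- The list is built from its end, together with the number that was put in front last.
  have := foldr (l := fun a => List.replicate (k a) Tree.nil) (eb := fun _ t => t)
    (V := fun a l' => .cons (encNat (k a - l'.length))
      (encList ((List.range' (k a - l'.length) l'.length).map encNat)))
    (hk.congr fun a => by rw [List.map_id', encNat_eq_encList])
    (hlen.mono fun a => by simp) ((hk.cons nil).congr fun a => by simp [encList])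
    ((PolyTime.arg.tl.tl.hd.tl.cons (PolyTime.arg.tl.tl.hd.tl.cons PolyTime.arg.tl.tl.tl)).congr
      fun x => by
        have h := x.2.2.length_le
        simp only [List.length_cons, List.length_replicate] at h
        have h1 : k x.1 - x.2.1.2.length - 1 = k x.1 - (x.2.1.2.length + 1) := by omega
        have h2 : k x.1 - x.2.1.2.length = k x.1 - (x.2.1.2.length + 1) + 1 := by omega
        simp only [Tree.tl_cons, Tree.hd_cons, encNat_tl, List.length_cons, List.range'_succ,
          List.map_cons, encList, h1, h2.symm])
  exact this.tl.congr fun a => by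
    simp only [Tree.tl, List.length_replicate, Nat.sub_self]
    rw [← List.range_eq_range', ← List.map_coe_finRange_eq_range, List.map_map]
    rfl

section Fin

variable {k : α → ℕ}

theorem forall_fin {p : ∀ a, Fin (k a) → Prop} (hk : PolyTime M i fun a => encNat (k a))
    (hlen : PolyBounded M k)
    (hp : PolyTime (fun x : Σ a, Fin (k a) => M x.1)
      (fun x => .cons (i x.1) (encNat x.2)) fun x => truth (p x.1 x.2)) :
    PolyTime M i fun a => truth (∀ s, p a s) :=
  (forall_mem (p := p) (finRange hk hlen) (hlen.mono fun a => by simp)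
    (hp.comap fun x : Σ a, {s // s ∈ List.finRange (k a)} =>
      (⟨x.1, x.2.1⟩ : Σ a, Fin (k a)))).iff_congr fun a => by simp

/-- The table of a function on `Fin (k a)`. -/
theorem ofFn {g : ∀ a, Fin (k a) → Tree} (hk : PolyTime M i fun a => encNat (k a))
    (hlen : PolyBounded M k)
    (hg : PolyTime (fun x : Σ a, Fin (k a) => M x.1)
      (fun x => .cons (i x.1) (encNat x.2)) fun x => g x.1 x.2) :
    PolyTime M i fun a => encList (List.ofFn (g a)) :=
  (map (g := g) (finRange hk hlen) (hlen.mono fun a => by simp)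
    (hg.comap fun x : Σ a, {s // s ∈ List.finRange (k a)} =>
      (⟨x.1, x.2.1⟩ : Σ a, Fin (k a)))).congr fun a => by rw [List.ofFn_eq_map]

theorem filter_fin {p : ∀ a, Fin (k a) → Bool} (hk : PolyTime M i fun a => encNat (k a))
    (hlen : PolyBounded M k)
    (hp : PolyTime (fun x : Σ a, Fin (k a) => M x.1)
      (fun x => .cons (i x.1) (encNat x.2)) fun x => truth (p x.1 x.2 = true)) :
    PolyTime M i fun a =>
      encList (((List.finRange (k a)).filter (p a)).map fun s : Fin (k a) => encNat s) :=
  filter (p := p) (finRange hk hlen) (hlen.mono fun a => by simp)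
    (hp.comap fun x : Σ a, {s // s ∈ List.finRange (k a)} => (⟨x.1, x.2.1⟩ : Σ a, Fin (k a)))

end Fin

end PolyTime

/-! ### The game with representative users -/

namespace Schema

variable {S U : Type} {W : Schema S U} {t r : ℕ} {π : Plan S U} {u u' : U}

/-- A permutation of the users acts on the plans. -/
def permute (φ : Equiv.Perm U) (π : Plan S U) : Plan S U := fun s => (π s).map φ

theorem Ready.permute {s : S} (h : W.Ready π s) (φ : Equiv.Perm U) :
    W.Ready (Schema.permute φ π) s := by
  simpa [Ready, Schema.permute] using h

theorem Valid.permute (hW : W.UserIndependent) {φ : Equiv.Perm U}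
    (hφ : ∀ s u, W.auth s (φ u) ↔ W.auth s u) (h : W.Valid π) :
    W.Valid (Schema.permute φ π) := by
  refine ⟨fun s u hu => ?_, fun c hc θ hθ => ?_⟩
  · obtain ⟨v, hv, rfl⟩ := Option.map_eq_some_iff.1 hu
    exact (hφ s v).2 (h.1 s v hv)
  · have := hW c hc _ (h.2 c hc (fun s => φ.symm (θ s)) fun s => ?_) φ
    · simpa using this
    · obtain ⟨v, hv, hv'⟩ := Option.map_eq_some_iff.1 (hθ s)
      rw [hv, ← hv', Equiv.symm_apply_apply]

variable [DecidableEq S]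

theorem permute_update (φ : Equiv.Perm U) (s : S) (u : U) :
    permute φ (Function.update π s (some u)) =
      Function.update (permute φ π) s (some (φ u)) := by
  funext s'
  by_cases h : s' = s
  · subst h; simp [permute]
  · simp [permute, h]

/-- Player 1 has a winning move that names the user `u`, when `r` rounds remain after this move. -/
def Good (W : Schema S U) (t r : ℕ) (π : Plan S U) (u : U) : Prop :=
  ∃ s, W.Ready π s ∧ W.Valid (Function.update π s (some u)) ∧
    W.CanWin t r (Function.update π s (some u))

open Classical in
/-- Player 2 can block all winning moves if and only if they involve at most `t` users. -/
theorem canWin_succ_iff_card [Fintype U] :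
    W.CanWin t (r + 1) π ↔ t < (Finset.univ.filter (W.Good t r π)).card := by
  constructor
  · intro h
    by_contra! hle
    obtain ⟨s, u, hs, hu, hv, hw⟩ := h _ hle
    exact hu (by simpa using ⟨s, hs, hv, hw⟩)
  · intro h B hB
    obtain ⟨u, hu, huB⟩ := Finset.exists_mem_notMem_of_card_lt_card (hB.trans_lt h)
    obtain ⟨s, hs, hv, hw⟩ := (Finset.mem_filter.1 hu).2
    exact ⟨s, u, hs, huB, hv, hw⟩

/-- Renaming the users by a permutation that preserves the authorizations preserves winning
positions. -/
theorem CanWin.permute [DecidableEq U] (hW : W.UserIndependent) {φ : Equiv.Perm U}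
    (hφ : ∀ s u, W.auth s (φ u) ↔ W.auth s u) (h : W.CanWin t r π) :
    W.CanWin t r (Schema.permute φ π) := by
  induction r generalizing π with
  | zero => trivial
  | succ r ih =>
    intro B hB
    obtain ⟨s, u, hs, hu, hv, hw⟩ := h (B.image φ.symm) (Finset.card_image_le.trans hB)
    refine ⟨s, φ u, hs.permute φ, fun hB => hu ?_, ?_, ?_⟩
    · simpa using Finset.mem_image_of_mem φ.symm hB
    · rw [← permute_update]
      exact hv.permute hW hφ
    · rw [← permute_update]
      exact ih hw

/-- Two users with the same authorizations, neither of which occurs in the plan, are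
interchangeable. -/
theorem Good.of_sameAuth [DecidableEq U] (hW : W.UserIndependent)
    (huu' : ∀ s, W.auth s u ↔ W.auth s u') (hu : ∀ s, π s ≠ some u) (hu' : ∀ s, π s ≠ some u')
    (h : W.Good t r π u) : W.Good t r π u' := by
  have hφ : ∀ s v, W.auth s (Equiv.swap u u' v) ↔ W.auth s v := by
    intro s v
    by_cases h1 : v = u
    · subst h1; simp [huu']
    by_cases h2 : v = u'
    · subst h2; simp [huu']
    rw [Equiv.swap_apply_of_ne_of_ne h1 h2]
  have hπ : Schema.permute (Equiv.swap u u') π = π := by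
    funext s
    cases hs : π s with
    | none => simp [Schema.permute, hs]
    | some v =>
      have h1 : v ≠ u := fun hv => hu s (by rw [hs, hv])
      have h2 : v ≠ u' := fun hv => hu' s (by rw [hs, hv])
      simp [Schema.permute, hs, Equiv.swap_apply_of_ne_of_ne h1 h2]
  obtain ⟨s, hs, hv, hw⟩ := h
  refine ⟨s, hs, ?_, ?_⟩
  · have := hv.permute hW hφ
    rwa [permute_update, hπ, Equiv.swap_apply_left] at this
  · have := hw.permute hW hφ
    rwa [permute_update, hπ, Equiv.swap_apply_left] at this

open Classical in
/-- If every user outside `K` has the same authorizations as more than `|S| + t` users in `K`, and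
only users in `K` occur in the plan, then only the users in `K` have to be counted: more than `t`
of them do not occur in the plan, as at most `|S|` users do, and they are interchangeable with the
user outside `K`. -/
theorem canWin_succ_iff_card_of_representative [Fintype S] [Fintype U] (hW : W.UserIndependent)
    (K : Finset U)
    (hK : ∀ u ∉ K, Fintype.card S + t < (K.filter fun u' => ∀ s, W.auth s u ↔ W.auth s u').card)
    (hπ : ∀ s u, π s = some u → u ∈ K) :
    W.CanWin t (r + 1) π ↔ t < (K.filter (W.Good t r π)).card := by
  rw [canWin_succ_iff_card]
  refine ⟨fun h => ?_, fun h => h.trans_le (Finset.card_le_card (Finset.filter_subset_filter _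
    (Finset.subset_univ K)))⟩
  by_cases hsub : Finset.univ.filter (W.Good t r π) ⊆ K
  · refine h.trans_le (Finset.card_le_card fun u hu => ?_)
    exact Finset.mem_filter.2 ⟨hsub hu, (Finset.mem_filter.1 hu).2⟩
  obtain ⟨u, hu, huK⟩ := Finset.not_subset.1 hsub
  set E := K.filter fun u' => ∀ s, W.auth s u ↔ W.auth s u' with hE
  set V := Finset.univ.filter fun v => ∃ s, π s = some v with hV
  have hVcard : V.card ≤ Fintype.card S := by
    have : V.map Function.Embedding.some ⊆ Finset.univ.image π := by
      intro v hv
      obtain ⟨w, hw, rfl⟩ := Finset.mem_map.1 hv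
      obtain ⟨s, hs⟩ := (Finset.mem_filter.1 hw).2
      exact Finset.mem_image.2 ⟨s, Finset.mem_univ _, hs⟩
    simpa using (Finset.card_le_card this).trans Finset.card_image_le
  have hEV : E \ V ⊆ K.filter (W.Good t r π) := by
    intro u' hu'
    obtain ⟨h1, h2⟩ := Finset.mem_sdiff.1 hu'
    obtain ⟨h3, h4⟩ := Finset.mem_filter.1 h1
    refine Finset.mem_filter.2 ⟨h3, (Finset.mem_filter.1 hu).2.of_sameAuth hW h4 ?_ ?_⟩
    · exact fun s hs => huK (hπ s u hs)
    · exact fun s hs => h2 (by simpa [hV] using ⟨s, hs⟩)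
  have h1 : _ < E.card := hK u huK
  have h2 := Finset.le_card_sdiff V E
  have h3 := Finset.card_le_card hEV
  omega

end Schema

namespace Instance

variable (I : Instance)

/-- Two users are authorized for the same steps. -/
def SameAuth (u u' : Fin I.n) : Prop := ∀ s, I.auth s u = true ↔ I.auth s u' = true

open Classical in
/-- The twins of a user, that is, the users with the same authorizations, that have a smaller
number. -/
noncomputable def smallerTwins (u : Fin I.n) : List (Fin I.n) :=
  (List.finRange I.n).filter fun u' => u' < u ∧ I.SameAuth u u'

/-- From each class of users with the same authorizations, the first `k + t + 1` ones. -/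
noncomputable def kept : List (Fin I.n) :=
  (List.finRange I.n).filter fun u => (I.smallerTwins u).length ≤ I.k + I.t

variable {I}

theorem nodup_smallerTwins (u : Fin I.n) : (I.smallerTwins u).Nodup :=
  (List.nodup_finRange _).filter _

theorem nodup_kept : I.kept.Nodup := (List.nodup_finRange _).filter _

theorem mem_smallerTwins {u u' : Fin I.n} :
    u' ∈ I.smallerTwins u ↔ u' < u ∧ I.SameAuth u u' := by
  simp [smallerTwins]

theorem mem_kept {u : Fin I.n} : u ∈ I.kept ↔ (I.smallerTwins u).length ≤ I.k + I.t := by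
  simp [kept]

open Classical in
/-- A user that is not kept has more than `k + t` smaller twins. If one of them is not kept either,
it has more than `k + t` kept twins by induction, and these are twins of the given user. -/
theorem card_sameAuth_of_notMem_kept {u : Fin I.n} (hu : u ∉ I.kept) :
    I.k + I.t < (I.kept.toFinset.filter (I.SameAuth u)).card := by
  induction u using WellFoundedLT.induction with
  | _ u ih =>
    by_cases h : ∀ v ∈ I.smallerTwins u, v ∈ I.kept
    · rw [mem_kept, not_le, ← List.toFinset_card_of_nodup (nodup_smallerTwins u)] at hu
      refine hu.trans_le (Finset.card_le_card fun v hv => ?_)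
      rw [List.mem_toFinset] at hv
      simpa using ⟨h v hv, (mem_smallerTwins.1 hv).2⟩
    · push Not at h
      obtain ⟨v, hv, hvK⟩ := h
      obtain ⟨hlt, hvu⟩ := mem_smallerTwins.1 hv
      refine (ih v hlt hvK).trans_le (Finset.card_le_card fun w hw => ?_)
      simp only [Finset.mem_filter] at hw ⊢
      exact ⟨hw.1, fun s => (hvu s).trans (hw.2 s)⟩

theorem length_kept_le : I.kept.length ≤ 2 ^ I.k * (I.k + I.t + 1) := by
  have h : I.kept.toFinset.card ≤
      ((Finset.univ : Finset (Fin I.k → Bool)) ×ˢ Finset.range (I.k + I.t + 1)).card := by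
    refine Finset.card_le_card_of_injOn
      (fun u => (fun s => I.auth s u, (I.smallerTwins u).length)) (fun u hu => ?_) ?_
    · have := mem_kept.1 (List.mem_toFinset.1 hu)
      simpa using Nat.lt_succ_of_le this
    · have key : ∀ u v : Fin I.n, (fun s => I.auth s u) = (fun s => I.auth s v) → u < v →
          (I.smallerTwins u).length < (I.smallerTwins v).length := by
        intro u v huv hlt
        have hs : ∀ s, I.auth s u = I.auth s v := fun s => congrFun huv s
        rw [← List.toFinset_card_of_nodup (nodup_smallerTwins u),
          ← List.toFinset_card_of_nodup (nodup_smallerTwins v)]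
        refine Finset.card_lt_card ⟨fun w hw => ?_, fun hsub => ?_⟩
        · rw [List.mem_toFinset, mem_smallerTwins] at hw ⊢
          exact ⟨hw.1.trans hlt, fun s => by rw [← hs s]; exact hw.2 s⟩
        · have : u ∈ (I.smallerTwins u).toFinset := hsub (by
            rw [List.mem_toFinset, mem_smallerTwins]
            exact ⟨hlt, fun s => by rw [hs s]⟩)
          rw [List.mem_toFinset, mem_smallerTwins] at this
          exact absurd this.1 (_root_.lt_irrefl u)
      intro u _ v _ huv
      obtain ⟨h1, h2⟩ := Prod.mk.inj huv
      rcases lt_trichotomy u v with hlt | heq | hlt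
      · exact absurd h2 (key u v h1 hlt).ne
      · exact heq
      · exact absurd h2 (key v u h1.symm hlt).ne'
  rw [List.toFinset_card_of_nodup nodup_kept] at h
  simpa [Finset.card_product] using h

open Classical in
theorem canWin_succ_iff_countP {Θ : ConstraintLanguage} (hI : (I.schema Θ).UserIndependent)
    {r : ℕ} {π : Plan (Fin I.k) (Fin I.n)} (hπ : ∀ s u, π s = some u → u ∈ I.kept) :
    (I.schema Θ).CanWin I.t (r + 1) π ↔ I.t < I.kept.countP ((I.schema Θ).Good I.t r π) := by
  rw [Schema.canWin_succ_iff_card_of_representative hI I.kept.toFinset (fun u hu => ?_)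
    (by simpa using hπ), List.countP_eq_length_filter,
    ← List.toFinset_card_of_nodup (nodup_kept.filter _), List.toFinset_filter]
  · simp
  · have := card_sameAuth_of_notMem_kept (mt List.mem_toFinset.2 hu)
    rw [Fintype.card_fin]
    convert this using 4
    rfl

end Instance

/-! ### Sizes of encodings -/

theorem size_encNat (n : ℕ) : (encNat n).size = 2 * n + 1 := by
  induction n with
  | zero => rfl
  | succ n ih => simp only [encNat, Tree.size, ih]; omega

theorem size_lt_size_encList {l : List Tree} {a : Tree} (h : a ∈ l) :
    a.size < (encList l).size := by
  induction l with
  | nil => simp at h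
  | cons b l ih =>
    simp only [encList, Tree.size]
    rcases List.mem_cons.1 h with rfl | h
    · omega
    · have := ih h
      omega

theorem length_le_size_encList (l : List Tree) : l.length ≤ (encList l).size := by
  induction l with
  | nil => simp
  | cons b l ih => simp only [encList, Tree.size, List.length_cons]; omega

theorem size_encList_le {l : List Tree} {m : ℕ} (h : ∀ a ∈ l, a.size ≤ m) :
    (encList l).size ≤ l.length * (m + 1) + 1 := by
  induction l with
  | nil => simp [encList, Tree.size]
  | cons b l ih =>
    have h1 := h b List.mem_cons_self
    have h2 := ih fun a ha => h a (List.mem_cons_of_mem _ ha)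
    simp only [encList, Tree.size, List.length_cons]
    rw [add_mul]
    omega

theorem size_encAssignment_le {k n : ℕ} (T : Finset (Fin k)) (θ : T → Fin n) :
    (encAssignment T θ).size ≤ k * (2 * n + 4) + 1 := by
  refine (size_encList_le (m := 2 * n + 3) fun a ha => ?_).trans (by simp)
  obtain ⟨s, rfl⟩ := (List.mem_ofFn' _ _).1 ha
  by_cases h : s ∈ T
  · have := (θ ⟨s, h⟩).2
    simp only [h, dif_pos, encList, Tree.size, size_encNat]
    omega
  · simp [h, Tree.size]

namespace Instance

variable (I : Instance)

theorem size_mem {x : Tree} (h : x ∈ [encNat I.k, encNat I.n, encNat I.t, encMatrix I.lt,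
    encMatrix I.auth, encList (I.constraints.map fun q => .cons (encScope q.1) q.2)]) :
    x.size < I.encode.size :=
  size_lt_size_encList h

theorem k_le_size : I.k ≤ I.encode.size := by
  have := I.size_mem (x := encNat I.k) (by simp)
  rw [size_encNat] at this
  omega

theorem n_le_size : I.n ≤ I.encode.size := by
  have := I.size_mem (x := encNat I.n) (by simp)
  rw [size_encNat] at this
  omega

theorem t_le_size : I.t ≤ I.encode.size := by
  have := I.size_mem (x := encNat I.t) (by simp)
  rw [size_encNat] at this
  omega

theorem length_constraints_le_size : I.constraints.length ≤ I.encode.size := by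
  have := I.size_mem (x := encList (I.constraints.map fun q => .cons (encScope q.1) q.2)) (by simp)
  have h := length_le_size_encList (I.constraints.map fun q => .cons (encScope q.1) q.2)
  rw [List.length_map] at h
  omega

theorem size_description_le {q : Finset (Fin I.k) × Tree} (hq : q ∈ I.constraints) :
    q.2.size ≤ I.encode.size := by
  have := I.size_mem (x := encList (I.constraints.map fun q => .cons (encScope q.1) q.2)) (by simp)
  have h := size_lt_size_encList
    (List.mem_map_of_mem (f := fun q : Finset (Fin I.k) × Tree => .cons (encScope q.1) q.2) hq)
  simp only [Tree.size] at h
  omega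

end Instance

/-! ### Computing with instances and plans -/

/-- The entry of the table of a plan for one step. -/
def encEntry {n : ℕ} : Option (Fin n) → Tree
  | none => .nil
  | some u => encList [encNat u]

/-- The table of a plan. On the domain of the plan, it agrees with the table of an assignment. -/
def encPlan {k n : ℕ} (π : Plan (Fin k) (Fin n)) : Tree :=
  encList (List.ofFn fun s => encEntry (π s))

theorem encEntry_ne_nil {n : ℕ} {o : Option (Fin n)} : encEntry o ≠ .nil ↔ o ≠ none := by
  cases o <;> simp [encEntry, encList]

theorem encEntry_get {n : ℕ} {o : Option (Fin n)} (h : o.isSome) :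
    (encEntry o).hd = encNat (o.get h) := by
  cases o with
  | none => simp at h
  | some u => rfl

namespace PolyTime

variable {α : Type} {M : α → ℕ} {i : α → Tree} {Θ : ConstraintLanguage}

/-- The checker of a constraint language can be called where its input is small enough. -/
theorem mem_language (hΘ : Θ.PolyTimeCheckable) {k n : α → ℕ} {T : ∀ a, Finset (Fin (k a))}
    {d : α → Tree} {θ : ∀ a, T a → Fin (n a)} (hk : PolyTime M i fun a => encNat (k a))
    (hn : PolyTime M i fun a => encNat (n a)) (hd : PolyTime M i d)
    (hθ : PolyTime M i fun a => encAssignment (T a) (θ a)) (hkM : PolyBounded M k)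
    (hnM : PolyBounded M n) (hdM : PolyBounded M fun a => (d a).size) :
    PolyTime M i fun a => truth (θ a ∈ Θ (k a) (n a) (T a) (d a)) := by
  obtain ⟨P, p, H⟩ := hΘ
  choose v m hev hm hv using fun a => H (k a) (n a) (T a) (d a) (θ a)
  set x : α → Tree := fun a => encList [encNat (k a), encNat (n a), d a, encAssignment (T a) (θ a)]
    with hx
  have hxM : PolyBounded M fun a => (x a).size := by
    refine ((((((PolyBounded.const 2).mul hkM).add ((PolyBounded.const 2).mul hnM)).add hdM).add
      (hkM.mul (((PolyBounded.const 2).mul hnM).add (.const 4)))).add (.const 20)).mono fun a => ?_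
    have := size_encAssignment_le (T a) (θ a)
    simp only [hx, encList, Tree.size, size_encNat]
    omega
  have hxv : PolyTime M x v := ⟨P, .call 0 .arg, _, hxM.eval p, fun a => ⟨m a, hm a, hev a⟩⟩
  have hix : PolyTime M i x := hk.cons (hn.cons (hd.cons (hθ.cons nil)))
  exact (hix.comp hxv).ne_nil.iff_congr hv

section Access

variable {I : α → Instance}

/-- The instance `I a` can be read off, and its size is at most `M a`. -/
structure Provides (M : α → ℕ) (i : α → Tree) (I : α → Instance) : Prop where
  encode : PolyTime M i fun a => (I a).encode
  size_le : ∀ a, (I a).encode.size ≤ M a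

namespace Provides

theorem outer (h : Provides M i I) {γ : α → Type} (j : (Σ a, γ a) → Tree) :
    Provides (fun x : Σ a, γ a => M x.1) (fun x => .cons (i x.1) (j x)) fun x => I x.1 :=
  ⟨h.encode.outer j, fun x => h.size_le x.1⟩

theorem restrict (h : Provides M i I) (p : α → Prop) :
    Provides (fun a : {a // p a} => M a) (fun a => i a) fun a => I a :=
  ⟨h.encode.restrict p, fun a => h.size_le a⟩

theorem k (h : Provides M i I) : PolyTime M i fun a => encNat (I a).k := h.encode.hd

theorem n (h : Provides M i I) : PolyTime M i fun a => encNat (I a).n := h.encode.tl.hd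

theorem t (h : Provides M i I) : PolyTime M i fun a => encNat (I a).t := h.encode.tl.tl.hd

theorem k_bounded (h : Provides M i I) : PolyBounded M fun a => (I a).k :=
  PolyBounded.self.mono fun a => (I a).k_le_size.trans (h.size_le a)

theorem n_bounded (h : Provides M i I) : PolyBounded M fun a => (I a).n :=
  PolyBounded.self.mono fun a => (I a).n_le_size.trans (h.size_le a)

theorem t_bounded (h : Provides M i I) : PolyBounded M fun a => (I a).t :=
  PolyBounded.self.mono fun a => (I a).t_le_size.trans (h.size_le a)

theorem lt (h : Provides M i I) {s s' : ∀ a, Fin (I a).k} (hs : PolyTime M i fun a => encNat (s a))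
    (hs' : PolyTime M i fun a => encNat (s' a)) :
    PolyTime M i fun a => truth ((I a).lt (s a) (s' a) = true) := by
  have h1 : PolyTime M i fun a => encMatrix (I a).lt := h.encode.tl.tl.tl.hd
  have h2 := (h1.getFin hs h.k_bounded).getFin hs' h.k_bounded
  exact h2.congr fun a => encBool_eq_truth _

theorem auth (h : Provides M i I) {s : ∀ a, Fin (I a).k} {u : ∀ a, Fin (I a).n}
    (hs : PolyTime M i fun a => encNat (s a)) (hu : PolyTime M i fun a => encNat (u a)) :
    PolyTime M i fun a => truth ((I a).auth (s a) (u a) = true) := by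
  have h1 : PolyTime M i fun a => encMatrix (I a).auth := h.encode.tl.tl.tl.tl.hd
  have h2 := (h1.getFin hs h.k_bounded).getFin hu h.n_bounded
  exact h2.congr fun a => encBool_eq_truth _

theorem entry_ne_none (h : Provides M i I)
    {π : ∀ a, Plan (Fin (I a).k) (Fin (I a).n)} {s : ∀ a, Fin (I a).k}
    (hπ : PolyTime M i fun a => encPlan (π a)) (hs : PolyTime M i fun a => encNat (s a)) :
    PolyTime M i fun a => truth (π a (s a) ≠ none) :=
  (hπ.getFin hs h.k_bounded).ne_nil.iff_congr fun _ => encEntry_ne_nil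

theorem ready (h : Provides M i I)
    {π : ∀ a, Plan (Fin (I a).k) (Fin (I a).n)} {s : ∀ a, Fin (I a).k}
    (hπ : PolyTime M i fun a => encPlan (π a)) (hs : PolyTime M i fun a => encNat (s a)) :
    PolyTime M i fun a => truth (((I a).schema Θ).Ready (π a) (s a)) := by
  refine ((h.entry_ne_none hπ hs).not.and (forall_fin
    (p := fun a s' => (I a).lt s' (s a) = true → π a s' ≠ none) h.k h.k_bounded
    (((h.outer _).lt PolyTime.inner (hs.outer _)).imp ?_))).iff_congr fun a => by
      rw [not_not]; rfl
  exact ((h.outer _).entry_ne_none (hπ.outer _) PolyTime.inner).restrict _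

theorem update (h : Provides M i I)
    {π : ∀ a, Plan (Fin (I a).k) (Fin (I a).n)} {s : ∀ a, Fin (I a).k}
    {u : ∀ a, Fin (I a).n} (hπ : PolyTime M i fun a => encPlan (π a))
    (hs : PolyTime M i fun a => encNat (s a)) (hu : PolyTime M i fun a => encNat (u a)) :
    PolyTime M i fun a => encPlan (Function.update (π a) (s a) (some (u a))) := by
  refine ofFn h.k h.k_bounded (ite_prop (p := fun x => x.2 = s x.1) ?_ ?_ ?_)
  · have hx : PolyTime (fun x : Σ a, Fin (I a).k => M x.1)
        (fun x => .cons (i x.1) (encNat x.2)) fun x => encNat x.2 := PolyTime.inner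
    have h1 := hx.le
      (hs.outer _) (h.k_bounded.comap _ |>.mono fun x => (s x.1).2.le)
    have h2 := (hs.outer _).le hx
      (h.k_bounded.comap _ |>.mono fun x => x.2.2.le)
    exact (h1.and h2).iff_congr fun x => by rw [Fin.ext_iff, le_antisymm_iff]
  · refine (((hu.outer fun x : Σ a, Fin (I a).k => encNat x.2).cons nil).restrict
      fun x => x.2 = s x.1).congr fun x => ?_
    rw [x.2, Function.update_self]
    rfl
  · refine (((hπ.outer _).getFin PolyTime.inner (h.k_bounded.comap _)).restrict _).congr
      fun x => ?_
    rw [Function.update_of_ne x.2]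

theorem authorized (h : Provides M i I) {π : ∀ a, Plan (Fin (I a).k) (Fin (I a).n)}
    (hπ : PolyTime M i fun a => encPlan (π a)) :
    PolyTime M i fun a => truth (((I a).schema Θ).Authorized (π a)) := by
  refine (forall_fin
    (p := fun a s => π a s ≠ none → ∀ u, π a s = some u → (I a).auth s u = true) h.k h.k_bounded
    (((h.outer _).entry_ne_none (hπ.outer _) PolyTime.inner).imp ?_)).iff_congr fun a => ?_
  · have hsome : ∀ x : {x : Σ a, Fin (I a).k // π x.1 x.2 ≠ none}, (π x.1.1 x.1.2).isSome :=
      fun x => Option.isSome_iff_ne_none.2 x.2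
    have hs := PolyTime.restrict (M := fun x : Σ a, Fin (I a).k => M x.1)
      (i := fun x => .cons (i x.1) (encNat x.2)) PolyTime.inner fun x => π x.1 x.2 ≠ none
    have hu := ((((hπ.outer (fun x : Σ a, Fin (I a).k => encNat x.2)).getFin PolyTime.inner
      (h.k_bounded.comap _)).restrict fun x => π x.1 x.2 ≠ none).hd).congr
        fun x => encEntry_get (hsome x)
    refine iff_congr (α := {x : Σ a, Fin (I a).k // π x.1 x.2 ≠ none})
      (p := fun x => (I x.1.1).auth x.1.2 ((π x.1.1 x.1.2).get (hsome x)) = true)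
      (((h.outer fun x : Σ a, Fin (I a).k => encNat x.2).restrict
        fun x => π x.1 x.2 ≠ none).auth hs hu)
      fun x => ⟨fun hx u hu => ?_, fun hx => hx _ (by simp)⟩
    simpa [hu] using hx
  · exact ⟨fun H s u hu => H s (by simp [hu]) u hu, fun H s _ u hu => H s u hu⟩

/-- A constraint has to be looked up only if its scope is contained in the domain of the plan, and
in this case the table of the plan yields that of the restriction. -/
theorem satisfies (h : Provides M i I) (hΘ : Θ.PolyTimeCheckable)
    {π : ∀ a, Plan (Fin (I a).k) (Fin (I a).n)}
    (hπ : PolyTime M i fun a => encPlan (π a)) :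
    PolyTime M i fun a =>
      truth (∀ c ∈ ((I a).schema Θ).constraints, Schema.Satisfies (π a) c) := by
  have hl : PolyTime M i fun a =>
      encList ((I a).constraints.map fun q => .cons (encScope q.1) q.2) :=
    h.encode.tl.tl.tl.tl.tl.hd
  set j : (Σ a, {q // q ∈ (I a).constraints}) → Tree :=
    fun x => .cons (encScope x.2.1.1) x.2.1.2
  have h₁ : Provides (fun x : Σ a, {q // q ∈ (I a).constraints} => M x.1) _ _ := h.outer j
  have hmask : PolyTime (fun x : Σ a, {q // q ∈ (I a).constraints} => M x.1)
      (fun x => .cons (i x.1) (j x)) fun x => encScope x.2.1.1 := PolyTime.inner.hd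
  have hscope : PolyTime
      (fun y : Σ x : (Σ a, {q // q ∈ (I a).constraints}), Fin (I x.1).k => M y.1.1)
      (fun y => .cons (.cons (i y.1.1) (j y.1)) (encNat y.2)) fun y => truth (y.2 ∈ y.1.2.1.1) :=
    ((hmask.outer _).getFin
      (α := Σ x : (Σ a, {q // q ∈ (I a).constraints}), Fin (I x.1).k) (k := fun y => (I y.1.1).k)
      (f := fun y s => encBool (decide (s ∈ y.1.2.1.1))) (s := fun y => y.2)
      PolyTime.inner (h₁.k_bounded.comap Sigma.fst)).congr fun y => by
        rw [encBool_eq_truth, decide_eq_true_iff]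
  refine (forall_mem (p := fun a q => (∀ s, s ∈ q.1 → π a s ≠ none) →
    Schema.Satisfies (π a) ⟨q.1, Θ (I a).k (I a).n q.1 q.2⟩) hl
    (PolyBounded.self.mono fun a => (I a).length_constraints_le_size.trans (h.size_le a))
    (imp (forall_fin h₁.k h₁.k_bounded (hscope.imp
      (((h₁.outer _).entry_ne_none ((hπ.outer _).outer _) PolyTime.inner).restrict _)))
      ?_)).iff_congr fun a => ?_
  · have hsome : ∀ (y : {x : Σ a, {q // q ∈ (I a).constraints} //
        ∀ s, s ∈ x.2.1.1 → π x.1 s ≠ none}) (s : y.1.2.1.1), (π y.1.1 s).isSome :=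
      fun y s => Option.isSome_iff_ne_none.2 (y.2 s s.2)
    have h₂ := h₁.restrict fun x => ∀ s, s ∈ x.2.1.1 → π x.1 s ≠ none
    have hd : PolyTime (fun x : Σ a, {q // q ∈ (I a).constraints} => M x.1)
        (fun x => .cons (i x.1) (j x)) fun x => x.2.1.2 := PolyTime.inner.tl
    refine (mem_language hΘ (T := fun y => y.1.2.1.1) (θ := fun y s => (π y.1.1 s).get (hsome y s))
      h₂.k h₂.n (hd.restrict _) ?_ h₂.k_bounded h₂.n_bounded
      (PolyBounded.self.mono fun y => ((I y.1.1).size_description_le y.1.2.2).trans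
        (h.size_le _))).iff_congr
      (q := fun y => Schema.Satisfies (π y.1.1)
        ⟨y.1.2.1.1, Θ (I y.1.1).k (I y.1.1).n y.1.2.1.1 y.1.2.1.2⟩) fun y => ⟨?_, ?_⟩
    · refine ofFn h₂.k h₂.k_bounded (ite_prop
        (hscope.comap fun z : Σ y : {x : Σ a, {q // q ∈ (I a).constraints} //
          ∀ s, s ∈ x.2.1.1 → π x.1 s ≠ none}, Fin (I y.1.1).k => ⟨z.1.1, z.2⟩) ?_ ?_)
      · refine ((((((hπ.outer j).restrict _).outer _).getFin PolyTime.inner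
          (h₂.k_bounded.comap Sigma.fst)).restrict _)).congr fun z => ?_
        have hz := hsome z.1.1 ⟨z.1.2, z.2⟩
        rw [dif_pos z.2]
        obtain ⟨u, hu⟩ := Option.isSome_iff_exists.1 hz
        simp [hu, encEntry]
      · exact nil.congr fun z => by rw [dif_neg z.2]
    · intro hy θ hθ
      convert hy using 1
      funext s
      simp [hθ s]
    · intro hy
      exact hy _ fun s => by simp
  · constructor
    · rintro H c ⟨q, hq, rfl⟩ θ hθ
      exact H q hq (fun s hs => by simp [hθ ⟨s, hs⟩]) θ hθ
    · exact fun H q hq _ => H _ ⟨q, hq, rfl⟩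

theorem valid (h : Provides M i I) (hΘ : Θ.PolyTimeCheckable)
    {π : ∀ a, Plan (Fin (I a).k) (Fin (I a).n)} (hπ : PolyTime M i fun a => encPlan (π a)) :
    PolyTime M i fun a => truth (((I a).schema Θ).Valid (π a)) :=
  (h.authorized hπ).and (h.satisfies hΘ hπ)

theorem kept (h : Provides M i I) :
    PolyTime M i fun a => encList ((I a).kept.map fun u : Fin (I a).n => encNat u) := by
  refine filter_fin h.n h.n_bounded ?_
  set j : (Σ a, Fin (I a).n) → Tree := fun x => encNat x.2
  have h₁ : Provides (fun x : Σ a, Fin (I a).n => M x.1) _ _ := h.outer j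
  have htwins : PolyTime (fun x : Σ a, Fin (I a).n => M x.1) (fun x => .cons (i x.1) (j x))
      fun x => encList (((I x.1).smallerTwins x.2).map fun u : Fin (I x.1).n => encNat u) := by
    refine filter_fin h₁.n h₁.n_bounded ?_
    set j' : (Σ x : Σ a, Fin (I a).n, Fin (I x.1).n) → Tree := fun y => encNat y.2
    have h₂ : Provides (fun y : Σ x : Σ a, Fin (I a).n, Fin (I x.1).n => M y.1.1) _ _ :=
      h₁.outer j'
    have hx : PolyTime (fun x : Σ a, Fin (I a).n => M x.1) (fun x => .cons (i x.1) (j x))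
        fun x => encNat x.2 := PolyTime.inner
    have hu : PolyTime (fun y : Σ x : Σ a, Fin (I a).n, Fin (I x.1).n => M y.1.1)
      (fun y => .cons (.cons (i y.1.1) (j y.1)) (j' y)) fun y => encNat y.1.2 :=
        hx.outer j'
    have hu' : PolyTime (fun y : Σ x : Σ a, Fin (I a).n, Fin (I x.1).n => M y.1.1)
      (fun y => .cons (.cons (i y.1.1) (j y.1)) (j' y)) fun y => encNat y.2 := PolyTime.inner
    refine ((hu.le hu' (h₂.n_bounded.mono fun y => y.2.2.le)).not.and
      (forall_fin (p := fun y s => (I y.1.1).auth s y.1.2 = true ↔ (I y.1.1).auth s y.2 = true)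
        h₂.k h₂.k_bounded
        (((h₂.outer _).auth PolyTime.inner (hu.outer _)).iff
          ((h₂.outer _).auth PolyTime.inner (hu'.outer _))))).iff_congr fun y => ?_
    simp [Instance.SameAuth]
  have := (h₁.k.drop h₁.k_bounded (h₁.t.drop h₁.t_bounded htwins)).ne_nil.not
  refine this.iff_congr fun x => ?_
  simp [encList_eq_nil, add_comm]

end Provides

end Access

end PolyTime

/-! ### The search -/

/-- The encoding of a list of users or of steps. -/
def encFinList {m : ℕ} (l : List (Fin m)) : Tree := encList (l.map fun s : Fin m => encNat s)

theorem encFinList_eq_nil {m : ℕ} {l : List (Fin m)} : encFinList l = .nil ↔ l = [] := by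
  simp [encFinList, encList_eq_nil]

theorem encFinList_hd {m : ℕ} {l : List (Fin m)} (h : l ≠ []) :
    (encFinList l).hd = encNat (l.head h) := by
  cases l with
  | nil => exact absurd rfl h
  | cons a l => rfl

theorem encFinList_tl {m : ℕ} (l : List (Fin m)) : (encFinList l).tl = encFinList l.tail := by
  cases l <;> rfl

/-- A state of the search. In the position `plan` with `rounds` rounds to play, it remains to find
out whether at least `needed` of the users in `users` have a winning move, where only the steps in
`steps` are left to be tried for the first one of these users. -/
structure SearchState (Θ : ConstraintLanguage) where
  inst : Instance
  ui : (inst.schema Θ).UserIndependent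
  rounds : ℕ
  plan : Plan (Fin inst.k) (Fin inst.n)
  plan_kept : ∀ s u, plan s = some u → u ∈ inst.kept
  needed : ℕ
  users : List (Fin inst.n)
  users_kept : ∀ u ∈ users, u ∈ inst.kept
  steps : List (Fin inst.k)

namespace SearchState

variable {Θ : ConstraintLanguage}

/-- The data that are the same for all states of a search: the instance, the kept users, and the
list of the steps. -/
noncomputable def encEnv (I : Instance) : Tree :=
  .cons I.encode (.cons (encFinList I.kept) (encFinList (List.finRange I.k)))

/-- The representation of a state. The components that are proofs are left out. -/
noncomputable def encode (S : SearchState Θ) : Tree :=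
  .cons (encEnv S.inst) (.cons (encNat S.rounds) (.cons (encPlan S.plan) (.cons (encNat S.needed)
    (.cons (encFinList S.users) (encFinList S.steps)))))

/-- The state from which to find out whether a position is winning. Without rounds to play, no
users are needed. -/
noncomputable def node (I : Instance) (hI : (I.schema Θ).UserIndependent) (r : ℕ)
    (π : Plan (Fin I.k) (Fin I.n)) (hπ : ∀ s u, π s = some u → u ∈ I.kept) : SearchState Θ where
  inst := I
  ui := hI
  rounds := r
  plan := π
  plan_kept := hπ
  needed := if r = 0 then 0 else I.t + 1
  users := I.kept
  users_kept := fun _ h => h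
  steps := List.finRange I.k

/-- The move is admissible. -/
def Legal (S : SearchState Θ) (s : Fin S.inst.k) (u : Fin S.inst.n) : Prop :=
  (S.inst.schema Θ).Ready S.plan s ∧
    (S.inst.schema Θ).Valid (Function.update S.plan s (some u))

/-- The move wins. -/
def Wins (S : SearchState Θ) (s : Fin S.inst.k) (u : Fin S.inst.n) : Prop :=
  (S.inst.schema Θ).Ready S.plan s ∧
    (S.inst.schema Θ).Valid (Function.update S.plan s (some u)) ∧
    (S.inst.schema Θ).CanWin S.inst.t (S.rounds - 1) (Function.update S.plan s (some u))

open Classical in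
/-- The number of users in `l` with a winning move, where for the first one only the steps in `l'`
are considered. -/
noncomputable def score (S : SearchState Θ) : List (Fin S.inst.n) → List (Fin S.inst.k) → ℕ
  | [], _ => 0
  | u :: l, l' => (if ∃ s ∈ l', S.Wins s u then 1 else 0) +
      l.countP ((S.inst.schema Θ).Good S.inst.t (S.rounds - 1) S.plan)

/-- What the search has to find out. -/
def Succeeds (S : SearchState Θ) : Prop := S.needed ≤ S.score S.users S.steps

open Classical in
theorem score_finRange (S : SearchState Θ) (l : List (Fin S.inst.n)) :
    S.score l (List.finRange S.inst.k) =
      l.countP ((S.inst.schema Θ).Good S.inst.t (S.rounds - 1) S.plan) := by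
  cases l with
  | nil => rfl
  | cons u l =>
    have hiff : (∃ s ∈ List.finRange S.inst.k, S.Wins s u) ↔
        (S.inst.schema Θ).Good S.inst.t (S.rounds - 1) S.plan u := by
      simp [Schema.Good, Wins]
    rw [score, List.countP_cons, add_comm]
    congr 1
    by_cases h : (S.inst.schema Θ).Good S.inst.t (S.rounds - 1) S.plan u
    · rw [if_pos (hiff.2 h), if_pos (decide_eq_true h)]
    · rw [if_neg (mt hiff.1 h), if_neg (by simpa using h)]

theorem score_cons_of_not_wins (S : SearchState Θ) {u : Fin S.inst.n} {s : Fin S.inst.k}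
    (h : ¬ S.Wins s u) (l : List (Fin S.inst.n)) (l' : List (Fin S.inst.k)) :
    S.score (u :: l) (s :: l') = S.score (u :: l) l' := by
  have : (∃ s' ∈ s :: l', S.Wins s' u) ↔ ∃ s' ∈ l', S.Wins s' u := by simp [h]
  rw [score, score]
  by_cases hex : ∃ s' ∈ l', S.Wins s' u
  · rw [if_pos (this.2 hex), if_pos hex]
  · rw [if_neg (mt this.1 hex), if_neg hex]

theorem succeeds_node {I : Instance} {hI : (I.schema Θ).UserIndependent} {r : ℕ}
    {π : Plan (Fin I.k) (Fin I.n)} {hπ : ∀ s u, π s = some u → u ∈ I.kept} :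
    (node I hI r π hπ).Succeeds ↔ (I.schema Θ).CanWin I.t r π := by
  cases r with
  | zero => simp [Succeeds, node, Schema.CanWin]
  | succ r =>
    rw [Instance.canWin_succ_iff_countP hI hπ]
    exact iff_of_eq (congrArg (fun m => I.t + 1 ≤ m)
      ((node I hI (r + 1) π hπ).score_finRange I.kept))

/-- The state after a legal move. -/
noncomputable def child (S : SearchState Θ) (s : Fin S.inst.k) (u : Fin S.inst.n)
    (hu : u ∈ S.inst.kept) : SearchState Θ :=
  node S.inst S.ui (S.rounds - 1) (Function.update S.plan s (some u)) fun s' v hv => by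
    by_cases h : s' = s
    · subst h
      simp at hv
      exact hv ▸ hu
    · rw [Function.update_of_ne h] at hv
      exact S.plan_kept s' v hv

/-- The state with other numbers and lists in the same position. -/
def goto (S : SearchState Θ) (c : ℕ) (l : List (Fin S.inst.n)) (hl : ∀ u ∈ l, u ∈ S.inst.kept)
    (l' : List (Fin S.inst.k)) : SearchState Θ :=
  { S with needed := c, users := l, users_kept := hl, steps := l' }

theorem tail_kept (S : SearchState Θ) : ∀ u ∈ S.users.tail, u ∈ S.inst.kept :=
  fun u hu => S.users_kept u (List.mem_of_mem_tail hu)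

/-- The state that succeeds trivially. -/
def succeeding (S : SearchState Θ) : SearchState Θ :=
  S.goto 0 [] (by simp) []

/-- The state that fails trivially. -/
def failing (S : SearchState Θ) : SearchState Θ :=
  S.goto 1 [] (by simp) []

/-- The remaining search after a winning move of the first user was found. -/
noncomputable def nextHit (S : SearchState Θ) : SearchState Θ :=
  S.goto (S.needed - 1) S.users.tail S.tail_kept (List.finRange S.inst.k)

/-- The remaining search after all steps of the first user were tried without success. -/
noncomputable def nextUser (S : SearchState Θ) : SearchState Θ :=
  S.goto S.needed S.users.tail S.tail_kept (List.finRange S.inst.k)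

/-- The remaining search after the first move was tried without success. -/
def nextStep (S : SearchState Θ) : SearchState Θ :=
  S.goto S.needed S.users S.users_kept S.steps.tail

open Classical in
/-- The state that decides whether the first move is a winning one. -/
noncomputable def test (S : SearchState Θ) (hu : S.users ≠ []) (hs : S.steps ≠ []) :
    SearchState Θ :=
  if S.Legal (S.steps.head hs) (S.users.head hu) then
    S.child (S.steps.head hs) (S.users.head hu) (S.users_kept _ (List.head_mem hu))
  else S.failing

open Classical in
/-- One step of the search, in the form that `PolyTime.search` expects. -/
noncomputable def step (S : SearchState Θ) : Tree :=
  if S.needed = 0 then .cons .nil (truth True)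
  else if hu : S.users = [] then .cons .nil (truth False)
  else if hs : S.steps = [] then .cons (truth True)
    (.cons S.succeeding.encode (.cons S.nextUser.encode S.nextUser.encode))
  else .cons (truth True)
    (.cons (S.test hu hs).encode (.cons S.nextHit.encode S.nextStep.encode))

/-- A bound for the number of states that are visited. There are at most `|S| + 1` states for each
user, and each leads to one search with fewer rounds to play. -/
noncomputable def cost (S : SearchState Θ) : ℕ :=
  if S.needed = 0 ∨ S.users = [] then 1
  else (S.users.length * (S.inst.k + 1) + S.steps.length + 1) *
    ((S.inst.kept.length + 1) * (S.inst.k + 1) + 1) ^ (S.rounds + 1)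

theorem cost_pos (S : SearchState Θ) : 0 < S.cost := by
  unfold cost
  split_ifs <;> positivity

theorem cost_le (S : SearchState Θ) :
    S.cost ≤ (S.users.length * (S.inst.k + 1) + S.steps.length + 1) *
      ((S.inst.kept.length + 1) * (S.inst.k + 1) + 1) ^ (S.rounds + 1) := by
  unfold cost
  split_ifs
  · exact Nat.one_le_iff_ne_zero.2 (by positivity)
  · exact le_rfl

/-- Let `b = (m + 1) * (k + 1) + 1` for `m` kept users. With `r` rounds to play, the search after
a move costs at most `(b - 1) * b ^ r`, which is less than `b ^ (r + 1)`. -/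
theorem cost_test_lt (S : SearchState Θ) (hu : S.users ≠ []) (hs : S.steps ≠ []) :
    (S.test hu hs).cost <
      ((S.inst.kept.length + 1) * (S.inst.k + 1) + 1) ^ (S.rounds + 1) := by
  have hone : 1 < ((S.inst.kept.length + 1) * (S.inst.k + 1) + 1) ^ (S.rounds + 1) :=
    Nat.one_lt_pow (by omega) (Nat.succ_lt_succ (by positivity))
  unfold test
  split_ifs
  · by_cases hr : S.rounds - 1 = 0
    · rwa [cost, if_pos (Or.inl (by simp [child, node, hr]))]
    · refine (cost_le _).trans_lt ?_
      have h1 : S.rounds - 1 + 1 = S.rounds := by omega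
      simp only [child, node, List.length_finRange, h1]
      rw [pow_succ, mul_comm]
      refine Nat.mul_lt_mul_of_pos_left ?_ (by positivity)
      rw [add_mul _ 1]
      omega
  · have : S.failing.cost = 1 := if_pos (Or.inr rfl)
    rwa [this]

theorem cost_tail_le (S : SearchState Θ) (hu : S.users ≠ []) (c : ℕ) :
    (S.goto c S.users.tail S.tail_kept (List.finRange S.inst.k)).cost ≤
      S.users.length * (S.inst.k + 1) *
        ((S.inst.kept.length + 1) * (S.inst.k + 1) + 1) ^ (S.rounds + 1) := by
  refine (cost_le _).trans (Nat.mul_le_mul_right _ ?_)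
  simp only [goto, List.length_tail, List.length_finRange]
  obtain ⟨n, hn⟩ := Nat.exists_eq_succ_of_ne_zero (List.length_pos_iff.2 hu).ne'
  rw [hn, Nat.succ_sub_one, Nat.succ_mul]
  omega

theorem cost_nextStep_le (S : SearchState Θ) (hs : S.steps ≠ []) :
    S.nextStep.cost ≤ (S.users.length * (S.inst.k + 1) + S.steps.length) *
        ((S.inst.kept.length + 1) * (S.inst.k + 1) + 1) ^ (S.rounds + 1) := by
  refine (cost_le _).trans (Nat.mul_le_mul_right _ ?_)
  simp only [nextStep, goto, List.length_tail]
  have := List.length_pos_iff.2 hs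
  omega

theorem succeeds_test (S : SearchState Θ) (hu : S.users ≠ []) (hs : S.steps ≠ []) :
    (S.test hu hs).Succeeds ↔ S.Wins (S.steps.head hs) (S.users.head hu) := by
  unfold test
  split_ifs with h
  · rw [child, succeeds_node, Wins, ← and_assoc]
    exact (and_iff_right h).symm
  · refine iff_of_false ?_ fun hw => h ⟨hw.1, hw.2.1⟩
    simp [Succeeds, failing, goto, score]

theorem succeeds_goto (S : SearchState Θ) (c : ℕ) (l : List (Fin S.inst.n))
    (hl : ∀ u ∈ l, u ∈ S.inst.kept) (l' : List (Fin S.inst.k)) :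
    (S.goto c l hl l').Succeeds ↔ c ≤ S.score l l' := by
  cases l <;> exact Iff.rfl

/-- The step of the search leads to the right states. -/
theorem step_spec (S : SearchState Θ) :
    S.step = .cons .nil (truth S.Succeeds) ∨ ∃ (u : Tree) (a b c : SearchState Θ), u ≠ Tree.nil ∧
      S.step = .cons u (.cons (encode a) (.cons (encode b) (encode c))) ∧
      a.inst = S.inst ∧ b.inst = S.inst ∧ c.inst = S.inst ∧
      ((a.Succeeds ∧ (S.Succeeds ↔ b.Succeeds) ∧ a.cost + b.cost < S.cost) ∨
        (¬ a.Succeeds ∧ (S.Succeeds ↔ c.Succeeds) ∧ a.cost + c.cost < S.cost)) := by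
  unfold step
  split_ifs with hc hu hs
  · left
    have : S.Succeeds := by rw [Succeeds, hc]; exact Nat.zero_le _
    rw [truth_of this, truth_of trivial]
  · left
    have : ¬ S.Succeeds := by rw [Succeeds, hu, score]; omega
    rw [truth_of_not this, truth_of_not not_false]
  · right
    refine ⟨_, _, _, _, truth_ne_nil.2 trivial, rfl, rfl, rfl, rfl, Or.inl ⟨?_, ?_, ?_⟩⟩
    · exact Nat.zero_le _
    · obtain ⟨u, l, hl⟩ := List.exists_cons_of_ne_nil hu
      rw [nextUser, succeeds_goto, Succeeds, score_finRange, hl, hs, score]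
      simp
    · have h1 : S.succeeding.cost = 1 := if_pos (Or.inl rfl)
      have h2 : S.nextUser.cost ≤ _ := S.cost_tail_le hu _
      have hone : 1 < ((S.inst.kept.length + 1) * (S.inst.k + 1) + 1) ^ (S.rounds + 1) :=
        Nat.one_lt_pow (by omega) (Nat.succ_lt_succ (by positivity))
      rw [cost.eq_def S, if_neg (by simp [hc, hu]), hs, List.length_nil, add_zero, add_mul, one_mul]
      omega
  · right
    refine ⟨_, _, _, _, truth_ne_nil.2 trivial, rfl, ?_, rfl, rfl, ?_⟩
    · unfold test
      split_ifs <;> rfl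
    rw [succeeds_test]
    have ht := S.cost_test_lt hu hs
    have hcost : S.cost = (S.users.length * (S.inst.k + 1) + S.steps.length + 1) *
        ((S.inst.kept.length + 1) * (S.inst.k + 1) + 1) ^ (S.rounds + 1) :=
      if_neg (by simp [hc, hu])
    obtain ⟨u, l, hl⟩ := List.exists_cons_of_ne_nil hu
    obtain ⟨s, l', hl'⟩ := List.exists_cons_of_ne_nil hs
    have hhu : S.users.head hu = u := by simp [hl]
    have hhs : S.steps.head hs = s := by simp [hl']
    rw [hhu, hhs]
    by_cases hw : S.Wins s u
    · refine Or.inl ⟨hw, ?_, ?_⟩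
      · rw [nextHit, succeeds_goto, Succeeds, score_finRange, hl, hl', score,
          if_pos ⟨s, List.mem_cons_self, hw⟩, List.tail_cons]
        omega
      · have h2 : S.nextHit.cost ≤ _ := S.cost_tail_le hu _
        rw [hcost, add_mul, add_mul]
        omega
    · refine Or.inr ⟨hw, ?_, ?_⟩
      · rw [nextStep, succeeds_goto, Succeeds, hl, hl', List.tail_cons,
          S.score_cons_of_not_wins hw]
      · have h2 := S.cost_nextStep_le hs
        rw [hcost, add_mul _ 1, one_mul]
        omega

end SearchState

namespace PolyTime

open SearchState

variable {α : Type} {M : α → ℕ} {i : α → Tree} {Θ : ConstraintLanguage}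

/-- States are put together from their parts. -/
theorem encode_goto {S : α → SearchState Θ} (hS : PolyTime M i fun a => (S a).encode)
    {c : α → ℕ} {l : ∀ a, List (Fin (S a).inst.n)} {hl : ∀ a, ∀ u ∈ l a, u ∈ (S a).inst.kept}
    {l' : ∀ a, List (Fin (S a).inst.k)} (hc : PolyTime M i fun a => encNat (c a))
    (h : PolyTime M i fun a => encFinList (l a)) (h' : PolyTime M i fun a => encFinList (l' a)) :
    PolyTime M i fun a => ((S a).goto (c a) (l a) (hl a) (l' a)).encode :=
  hS.hd.cons (hS.tl.hd.cons (hS.tl.tl.hd.cons (hc.cons (h.cons h'))))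

theorem encode_node {I : α → Instance} {hI : ∀ a, ((I a).schema Θ).UserIndependent} {r : α → ℕ}
    {π : ∀ a, Plan (Fin (I a).k) (Fin (I a).n)} {hπ : ∀ a s u, π a s = some u → u ∈ (I a).kept}
    (he : PolyTime M i fun a => encEnv (I a)) (hr : PolyTime M i fun a => encNat (r a))
    (h : PolyTime M i fun a => encPlan (π a)) :
    PolyTime M i fun a => (node (I a) (hI a) (r a) (π a) (hπ a)).encode := by
  refine he.cons (hr.cons (h.cons (PolyTime.cons ?_ (he.tl.hd.cons he.tl.tl))))
  refine hr.cases ?_ ?_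
  · have ht : PolyTime M i fun a => encNat (I a).t := he.hd.tl.tl.hd
    exact ((nil.cons ht).restrict _).congr fun a => by
      have := mt encNat_eq_nil.2 a.2
      simp [node, this, encNat]
  · exact nil.congr fun a => by
      have := encNat_eq_nil.1 a.2
      simp [node, this, encNat]

theorem encode_failing {S : α → SearchState Θ} (hS : PolyTime M i fun a => (S a).encode) :
    PolyTime M i fun a => (S a).failing.encode :=
  encode_goto hS (nil.cons nil) nil nil

theorem encode_test (hΘ : Θ.PolyTimeCheckable) {S : α → SearchState Θ}
    (hM : ∀ a, (S a).inst.encode.size ≤ M a) (hS : PolyTime M i fun a => (S a).encode)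
    (hu : ∀ a, (S a).users ≠ []) (hs : ∀ a, (S a).steps ≠ []) :
    PolyTime M i fun a => ((S a).test (hu a) (hs a)).encode := by
  have hI : Provides M i fun a => (S a).inst := ⟨hS.hd.hd, hM⟩
  have h1 : PolyTime M i fun a => encPlan (S a).plan := hS.tl.tl.hd
  have h2 : PolyTime M i fun a => encNat ((S a).users.head (hu a)) :=
    hS.tl.tl.tl.tl.hd.hd.congr fun a => encFinList_hd (hu a)
  have h3 : PolyTime M i fun a => encNat ((S a).steps.head (hs a)) :=
    hS.tl.tl.tl.tl.tl.hd.congr fun a => encFinList_hd (hs a)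
  have h4 := hI.update h1 h3 h2
  refine ite_prop (p := fun a => (S a).Legal ((S a).steps.head (hs a)) ((S a).users.head (hu a)))
    ((hI.ready h1 h3).and (hI.valid hΘ h4)) ?_ ?_
  · have hr : PolyTime M i fun a => encNat ((S a).rounds - 1) :=
      hS.tl.hd.tl.congr fun a => encNat_tl _
    have henv : PolyTime M i fun a => encEnv (S a).inst := hS.hd
    have hchild : PolyTime M i fun a => ((S a).child ((S a).steps.head (hs a))
        ((S a).users.head (hu a)) ((S a).users_kept _ (List.head_mem (hu a)))).encode :=
      encode_node henv hr h4
    exact (hchild.restrict _).congr fun a => by rw [test, if_pos a.2]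
  · exact ((encode_failing hS).restrict _).congr fun a => by rw [test, if_neg a.2]

theorem encode_step (hΘ : Θ.PolyTimeCheckable) {S : α → SearchState Θ}
    (hM : ∀ a, (S a).inst.encode.size ≤ M a) (hS : PolyTime M i fun a => (S a).encode) :
    PolyTime M i fun a => (S a).step := by
  have hc : PolyTime M i fun a => encNat (S a).needed := hS.tl.tl.tl.hd
  have hu : PolyTime M i fun a => encFinList (S a).users := hS.tl.tl.tl.tl.hd
  have hs : PolyTime M i fun a => encFinList (S a).steps := hS.tl.tl.tl.tl.tl
  have hall : PolyTime M i fun a => encFinList (List.finRange (S a).inst.k) := hS.hd.tl.tl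
  have htl : PolyTime M i fun a => encFinList (S a).users.tail :=
    hu.tl.congr fun a => encFinList_tl _
  have hsucc : PolyTime M i fun a => (S a).succeeding.encode := encode_goto hS nil nil nil
  have hhit : PolyTime M i fun a => (S a).nextHit.encode :=
    encode_goto hS (hc.tl.congr fun a => encNat_tl _) htl hall
  have huser : PolyTime M i fun a => (S a).nextUser.encode := encode_goto hS hc htl hall
  have hstep : PolyTime M i fun a => (S a).nextStep.encode :=
    encode_goto hS hc hu (hs.tl.congr fun a => encFinList_tl _)
  refine ite_prop (p := fun a => (S a).needed = 0)
    (hc.ne_nil.not.iff_congr fun a => by rw [not_not, encNat_eq_nil]) ?_ ?_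
  · exact (nil.cons (true_of fun _ => trivial)).congr fun a => by rw [SearchState.step, if_pos a.2]
  refine ite_prop (p := fun a => (S a.1).users = [])
    ((hu.ne_nil.not.restrict _).iff_congr fun a => by rw [not_not, encFinList_eq_nil]) ?_ ?_
  · exact (nil.cons (false_of fun _ => not_false)).congr fun a => by
      rw [SearchState.step, if_neg a.1.2, dif_pos a.2]
  refine ite_prop (p := fun a => (S a.1.1).steps = [])
    (((hs.ne_nil.not.restrict _).restrict _).iff_congr fun a => by
      rw [not_not, encFinList_eq_nil]) ?_ ?_
  · exact (((((true_of fun _ => trivial).cons (hsucc.cons (huser.cons huser))).restrict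
      _).restrict _).restrict _).congr fun a => by
        rw [SearchState.step, if_neg a.1.1.2, dif_neg a.1.2, dif_pos a.2]
  · have htest := encode_test hΘ (S := fun a : {a : {a : {a // ¬ (S a).needed = 0} //
        ¬ (S a.1).users = []} // ¬ (S a.1.1).steps = []} => S a.1.1.1) (fun a => hM a.1.1.1)
      (((hS.restrict _).restrict _).restrict _) (fun a => a.1.2) (fun a => a.2)
    refine PolyTime.congr ((true_of (p := fun _ => True) fun _ => trivial).cons (htest.cons
      ((((hhit.cons hstep).restrict _).restrict _).restrict _))) fun a => ?_
    rw [SearchState.step, if_neg a.1.1.2, dif_neg a.1.2, dif_neg a.2]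

end PolyTime

/-! ### The running time -/

/-- The factor of the running time that depends on the numbers of steps and of unavailable users:
with at most `2 ^ k * (k + t + 1)` kept users, it bounds the number of states of the search. -/
def searchBound (k t : ℕ) : ℕ := ((2 ^ k * (k + t + 1) + 1) * (k + 1) + 1) ^ (k + 2)

theorem primrec_pow : Primrec₂ fun a b : ℕ => a ^ b := by
  have h : Primrec₂ fun a b : ℕ => Nat.rec (motive := fun _ => ℕ) 1 (fun _ y => y * a) b :=
    Primrec.nat_rec (Primrec.const 1)
      (Primrec.nat_mul.comp (Primrec.snd.comp Primrec.snd) Primrec.fst).to₂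
  refine h.of_eq fun a b => ?_
  induction b with
  | zero => rfl
  | succ b ih => rw [pow_succ, ← ih]

theorem computable_searchBound : Computable₂ searchBound := by
  have hk : Primrec fun p : ℕ × ℕ => p.1 := Primrec.fst
  have hkt : Primrec fun p : ℕ × ℕ => p.1 + p.2 + 1 :=
    Primrec.succ.comp (Primrec.nat_add.comp Primrec.fst Primrec.snd)
  have hpow : Primrec fun p : ℕ × ℕ => 2 ^ p.1 := primrec_pow.comp (Primrec.const 2) hk
  have h : Primrec fun p : ℕ × ℕ => searchBound p.1 p.2 :=
    primrec_pow.comp (Primrec.succ.comp (Primrec.nat_mul.comp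
      (Primrec.succ.comp (Primrec.nat_mul.comp hpow hkt)) (Primrec.succ.comp hk)))
      (Primrec.succ.comp (Primrec.succ.comp hk))
  exact h.to_comp

open SearchState in
theorem SearchState.cost_node_le {Θ : ConstraintLanguage} (I : Instance)
    (hI : (I.schema Θ).UserIndependent) (π : Plan (Fin I.k) (Fin I.n))
    (hπ : ∀ s u, π s = some u → u ∈ I.kept) :
    (node I hI I.k π hπ).cost ≤ searchBound I.k I.t := by
  refine (cost_le _).trans ?_
  simp only [node, List.length_finRange]
  have h1 : I.kept.length * (I.k + 1) + I.k + 1 ≤ (I.kept.length + 1) * (I.k + 1) + 1 := by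
    rw [add_mul]
    omega
  have h2 : (I.kept.length + 1) * (I.k + 1) + 1 ≤
      (2 ^ I.k * (I.k + I.t + 1) + 1) * (I.k + 1) + 1 := by
    have := I.length_kept_le
    gcongr
  refine (Nat.mul_le_mul_right _ h1).trans ?_
  rw [← pow_succ']
  exact Nat.pow_le_pow_left h2 _

theorem PolyTime.encode_start {Θ : ConstraintLanguage} :
    PolyTime (fun I : {I : Instance // (I.schema Θ).UserIndependent} => I.1.encode.size)
      (fun I => I.1.encode)
      fun I => (SearchState.node I.1 I.2 I.1.k (fun _ => none) (by simp)).encode := by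
  have hI : Provides (fun I : {I : Instance // (I.schema Θ).UserIndependent} => I.1.encode.size)
      (fun I => I.1.encode) fun I => I.1 := ⟨PolyTime.arg, fun _ => le_rfl⟩
  exact encode_node (hI.encode.cons (hI.kept.cons (finRange hI.k hI.k_bounded))) hI.k
    (ofFn hI.k hI.k_bounded nil)

/-- The search decides dynamic resiliency. -/
theorem ConstraintLanguage.PolyTimeCheckable.exists_decidesWithin {Θ : ConstraintLanguage}
    (hΘ : Θ.PolyTimeCheckable) :
    ∃ (P : Program) (p : Polynomial ℕ), ∀ I : Instance, (I.schema Θ).UserIndependent →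
      DecidesWithin P I.encode (searchBound I.k I.t * p.eval I.encode.size)
        ((I.schema Θ).DynamicallyResilient I.t) := by
  have hstep := PolyTime.encode_step (M := fun S : SearchState Θ => S.inst.encode.size) hΘ
    (S := fun S => S) (fun _ => le_rfl) PolyTime.arg
  obtain ⟨P₁, e₁, p₁, H₁⟩ := hstep.search (F := fun S => truth S.Succeeds)
    (N := SearchState.cost) SearchState.cost_pos fun S => by
      rcases S.step_spec with h | ⟨u, a, b, c, hu, hy, ha, hb, hc, h⟩
      · exact Or.inl h
      · refine Or.inr ⟨u, a, b, c, hu, hy, by rw [ha], by rw [hb], by rw [hc], ?_⟩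
        exact h.imp
          (fun h => ⟨truth_ne_nil.2 h.1, by rw [h.2.1], h.2.2⟩)
          (fun h => ⟨truth_eq_nil.2 h.1, by rw [h.2.1], h.2.2⟩)
  obtain ⟨P₀, e₀, b₀, ⟨p₀, hp₀⟩, H₀⟩ := PolyTime.encode_start (Θ := Θ)
  set body : Expr := (Expr.letIn e₀ (e₁.shift P₀.length)).shift 1
  refine ⟨[body] ++ (P₀ ++ P₁.map (Expr.shift P₀.length)).map (Expr.shift 1),
    p₀ + p₁ + Polynomial.C 3, fun I hI => ?_⟩
  obtain ⟨τ₀, hτ₀, h₀⟩ := H₀ ⟨I, hI⟩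
  obtain ⟨τ₁, hτ₁, h₁⟩ := H₁ (SearchState.node I hI I.k (fun _ => none) (by simp))
  have hbody := (Eval.letIn (h₀.append _) (h₁.shift P₀)).shift [body]
  refine ⟨_, _, .call (b := body) rfl (.arg _) hbody, ?_, ?_⟩
  · have hpos : 0 < searchBound I.k I.t := Nat.pow_pos (Nat.succ_pos _)
    have hcost : τ₁ ≤ searchBound I.k I.t * p₁.eval I.encode.size :=
      hτ₁.trans (Nat.mul_le_mul_right _ (SearchState.cost_node_le I hI _ _))
    have hstart : τ₀ ≤ searchBound I.k I.t * p₀.eval I.encode.size :=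
      (hτ₀.trans (hp₀ ⟨I, hI⟩)).trans (Nat.le_mul_of_pos_left _ hpos)
    simp only [Polynomial.eval_add, Polynomial.eval_C, mul_add]
    omega
  · rw [truth_ne_nil, SearchState.succeeds_node, Schema.DynamicallyResilient, Fintype.card_fin]

end Workflow

/-- Dynamic `t`-resiliency of constrained workflow authorization schemas whose constraints are all
user-independent is decided in time `f(k, t) · p(|x|)`, where `|x|` is the size of the encoded
instance, `f` is computable (one function for all constraint languages) and `p` is a polynomial. -/
theorem mainTheorem3 :
    ∃ f : ℕ → ℕ → ℕ, Computable₂ f ∧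
      ∀ Θ : Workflow.ConstraintLanguage, Θ.PolyTimeCheckable →
        ∃ (P : Workflow.Program) (p : Polynomial ℕ),
          ∀ I : Workflow.Instance, (I.schema Θ).UserIndependent →
            Workflow.DecidesWithin P I.encode (f I.k I.t * p.eval I.encode.size)
              ((I.schema Θ).DynamicallyResilient I.t) :=
  ⟨Workflow.searchBound, Workflow.computable_searchBound, fun _ hΘ => hΘ.exists_decidesWithin⟩
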